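/- **Setting.** For a twice continuously differentiable $f:\mathbb R\to\mathbb R$ let $T_{f,j}(x,d)$ be its Taylor polynomial of degree $j\in\{1,2\}$ at $x$ and $\phi_{f,j}(x)=f(x)-\min_{|d|\le 1}T_{f,j}(x,d)$. Given $q\in\{1,2\}$, an accuracy $\epsilon$, $x_0$ and $\sigma_0$, and constants $0<\sigma_{\min}\le\sigma_0$, $0<\eta_1\le\eta_2<1$, $0<\gamma_1<1<\gamma_2<\gamma_3$, the AR2 algorithm stops at $x_k$ as soon as $\phi_{f,j}(x_k)<\epsilon/j$ for all $1\le j\le q$. Otherwise it takes a global minimizer $s_k$ of $T_{f,2}(x_k,s)+\frac{\sigma_k}{6}|s|^3$, computes $\rho_k=\frac{f(x_k)-f(x_k+s_k)}{T_{f,2}(x_k,0)-T_{f,2}(x_k,s_k)}$, sets $x_{k+1}=x_k+s_k$ if $\rho_k\ge\eta_1$ and $x_{k+1}=x_k$ otherwise, and chooses any $\sigma_{k+1}$ in $[\max(\sigma_{\min},\gamma_1\sigma_k),\sigma_k]$ if $\rho_k\ge\eta_2$, in $[\sigma_k,\gamma_2\sigma_k]$ if $\eta_1\le\rho_k<\eta_2$,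 and in $[\gamma_2\sigma_k,\gamma_3\sigma_k]$ if $\rho_k<\eta_1$. **Perturbed data.** Let $q\in\{1,2\}$, $p=3-q$, $\epsilon\in(0,\frac14]$, $K=\lceil\epsilon^{-3/p}\rceil$. Let $P\subset\mathbb R^{3K}$ be the set of all $\theta=\big((\beta_{0,k+1}),(\alpha_k),(\beta_{q,k})\big)_{0\le k<K}$ with, for all $k$, $$|\beta_{0,k+1}|\le\tfrac{1-\eta_1}{4},\quad \alpha_k\in[1,2],\quad \beta_{q,k}\in[0,\tfrac12]\ (q=1)\ \text{ or }\ \beta_{q,k}\in[-\tfrac12,0]\ (q=2),\quad \alpha_k(1+\beta_{q,k})\ge1$$ (the last condition is automatic for $q=1$). Put $\beta_{p,k}=-\beta_{q,k}$, $\alpha_K=\beta_{q,K}=\beta_{p,K}=0$, $s_k=(\alpha_k\epsilon)^{1/p}$, $x_k=\sum_{i<k}s_i$, and $$f_k^{(q)}=-(1+\beta_{q,k})\alpha_k\epsilon,\quad f_k^{(p)}=-\beta_{p,k}(\alpha_k\epsilon)^{q/p},\quad f_0^{(0)}=3\cdot2^{3/p},\quad f_{k+1}^{(0)}=f_k^{(0)}+f_k^{(1)}s_k+\tfrac12f_k^{(2)}s_k^2+\beta_{0,k+1}s_k^3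 .$$ **Theorem.** For each $q\in\{1,2\}$ there are constants $L,M$ such that, for every $\epsilon\in(0,\frac14]$ and all constants of AR2 as above with $\sigma_0=2$, there is a family $(f_\theta)_{\theta\in P}$ of functions $\mathbb R\to\mathbb R$ with the following properties. 1. Each $f_\theta$ is $C^2$ and piecewise polynomial (finitely many breakpoints, degree at most $5$), and is a single such polynomial on each $[x_k,x_{k+1}]$, $0\le k<K$. Moreover $|f_\theta^{(j)}|\le M$ on $\mathbb R$ for $j=0,1,2$, $f_\theta''$ is Lipschitz continuous with constant $L$, and $f_\theta^{(j)}(x_k)=f_k^{(j)}$ for $0\le k\le K$ and $j=0,1,2$. 2. For each $\theta\in P$, AR2 with accuracy $\epsilon$ started at $x_0=0$ on $f_\theta$ can produce exactly the iterates $x_0,\dots,x_K$ with steps $s_k$ and $\sigma_k=2$ for all $k$, stopping after exactly $K=\lceil\epsilon^{-3/p}\rceil$ iterations. In such a run it makes $K+1$ evaluations of $f_\theta$, $K+1$ of $f_\theta'$, and $K$ (if $q=1$) or $K+1$ (if $q=2$) of $f_\theta''$. 3. If $\theta\ne\theta'$ in $P$, there is an iterate $x_k$ of $\theta$ such that $f_\theta$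 and $f_{\theta'}$ do not coincide on any neighbourhood of $x_k$. 4. $P$ has positive Lebesgue measure in $\mathbb R^{3K}$, and $\theta\mapsto f_\theta$ is a homeomorphism of $P$ onto its image, both for the topology of uniform convergence on $\mathbb R$ and for that of uniform convergence on compact sets. 5. The set $\{f_\theta:\theta\in P\}$ has positive $3K$-dimensional Hausdorff measure in the space of bounded continuous functions on $\mathbb R$ with the uniform distance. Hence so does the set of all bounded $C^2$ functions with Lipschitz second derivative on which AR2, started at $0$ with accuracy $\epsilon$, can take exactly $\lceil\epsilon^{-3/p}\rceil$ iterations with the evaluation counts of item 2. -/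

import Mathlib

open MeasureTheory Set Filter Topology
open scoped BoundedContinuousFunction

noncomputable section

namespace AR2

/-! ### The algorithm, for univariate objective functions -/

/-- Taylor polynomial of `f` of degree `j` at `x`, as a function of the step `d`. -/
def taylor (f : ℝ → ℝ) (j : ℕ) (x d : ℝ) : ℝ :=
  ∑ i ∈ Finset.range (j + 1), iteratedDeriv i f x / (Nat.factorial i : ℝ) * d ^ i

/-- The `j`-th order criticality measure: the largest decrease of the `j`-th order Taylor
polynomial over steps of size at most one (the infimum is over a compact set, so attained). -/
def phi (f : ℝ → ℝ) (j : ℕ) (x : ℝ) : ℝ :=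
  f x - sInf (taylor f j x '' Icc (-1) 1)

/-- The cubically regularized quadratic model. -/
def model (f : ℝ → ℝ) (x σ s : ℝ) : ℝ :=
  taylor f 2 x s + σ / 6 * |s| ^ 3

/-- Ratio of achieved to predicted decrease. -/
def rho (f : ℝ → ℝ) (x s : ℝ) : ℝ :=
  (f x - f (x + s)) / (taylor f 2 x 0 - taylor f 2 x s)

/-- The constants of the algorithm. -/
structure Constants where
  sigma0 : ℝ
  sigmaMin : ℝ
  eta1 : ℝ
  eta2 : ℝ
  gamma1 : ℝ
  gamma2 : ℝ
  gamma3 : ℝ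
  sigmaMin_pos : 0 < sigmaMin
  sigmaMin_le : sigmaMin ≤ sigma0
  eta1_pos : 0 < eta1
  eta1_le : eta1 ≤ eta2
  eta2_lt : eta2 < 1
  gamma1_pos : 0 < gamma1
  gamma1_lt : gamma1 < 1
  gamma2_gt : 1 < gamma2
  gamma2_lt : gamma2 < gamma3

/-- The termination test passes at `x`: no `j ∈ {1, …, q}` has `φ_{f,j}(x) ≥ ε_j / j`. -/
def Terminates (q : ℕ) (acc : ℕ → ℝ) (f : ℝ → ℝ) (x : ℝ) : Prop :=
  ∀ j ∈ Finset.Icc 1 q, ¬ acc j / (j : ℝ) ≤ phi f j x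

/-- `x`, `s`, `σ` are the iterates, steps and regularization parameters of a possible execution
of the algorithm that starts at `x₀` and stops after exactly `K` iterations (only the values
`x 0, …, x K`, `σ 0, …, σ K` and `s 0, …, s (K - 1)` matter). -/
structure IsRun (c : Constants) (q : ℕ) (acc : ℕ → ℝ) (f : ℝ → ℝ) (x₀ : ℝ) (K : ℕ)
    (x s σ : ℕ → ℝ) : Prop where
  init_x : x 0 = x₀
  init_sigma : σ 0 = c.sigma0
  not_terminated : ∀ k < K, ¬ Terminates q acc f (x k)
  step : ∀ k < K, IsMinOn (model f (x k) (σ k)) univ (s k)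
  accept : ∀ k < K, c.eta1 ≤ rho f (x k) (s k) → x (k + 1) = x k + s k
  reject : ∀ k < K, rho f (x k) (s k) < c.eta1 → x (k + 1) = x k
  sigma_very_successful : ∀ k < K, c.eta2 ≤ rho f (x k) (s k) →
    σ (k + 1) ∈ Icc (max c.sigmaMin (c.gamma1 * σ k)) (σ k)
  sigma_successful : ∀ k < K, c.eta1 ≤ rho f (x k) (s k) → rho f (x k) (s k) < c.eta2 →
    σ (k + 1) ∈ Icc (σ k) (c.gamma2 * σ k)
  sigma_unsuccessful : ∀ k < K, rho f (x k) (s k) < c.eta1 →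
    σ (k + 1) ∈ Icc (c.gamma2 * σ k) (c.gamma3 * σ k)
  terminated : Terminates q acc f (x K)

/-- Evaluations of `f` in `K` iterations: one at the initial point, and one at each trial point. -/
def objEvals (K : ℕ) : ℕ := K + 1

open Classical in
/-- Evaluations of `f'`: at the initial point and after each successful iteration. -/
def gradEvals (c : Constants) (f : ℝ → ℝ) (K : ℕ) (x s : ℕ → ℝ) : ℕ :=
  1 + ((Finset.range K).filter fun k => c.eta1 ≤ rho f (x k) (s k)).card

open Classical in
/-- Evaluations of `f''`: one for each new iterate at which a step is computed, and, when `q = 2`,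
one for the final termination test. -/
def hessEvals (c : Constants) (q : ℕ) (f : ℝ → ℝ) (K : ℕ) (x s : ℕ → ℝ) : ℕ :=
  ((Finset.range K).filter fun k =>
    k = 0 ∨ c.eta1 ≤ rho f (x (k - 1)) (s (k - 1))).card + if q = 2 then 1 else 0

/-! ### The perturbed data -/

/-- The number of iterations `⌈ε^{-3/(3-q)}⌉`. -/
def kEps (q : ℕ) (ε : ℝ) : ℕ := ⌈ε ^ (-(3 / (3 - (q : ℝ))))⌉₊

/-- Perturbation parameters `(β_{0,k+1})_{k<K}`, `(α_k)_{k<K}`, `(β_{q,k})_{k<K}`. -/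
abbrev Param (K : ℕ) : Type := (Fin K → ℝ) × (Fin K → ℝ) × (Fin K → ℝ)

/-- `β_{0,k}` for `0 ≤ k ≤ K`, with `β_{0,0} = 0`. -/
def beta0 {K : ℕ} (θ : Param K) : ℕ → ℝ
  | 0 => 0
  | k + 1 => if h : k < K then θ.1 ⟨k, h⟩ else 0

/-- `α_k` for `0 ≤ k ≤ K`, with `α_K = 0`. -/
def alpha {K : ℕ} (θ : Param K) (k : ℕ) : ℝ := if h : k < K then θ.2.1 ⟨k, h⟩ else 0

/-- `β_{q,k}` for `0 ≤ k ≤ K`, with `β_{q,K} = 0`. -/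
def betaQ {K : ℕ} (θ : Param K) (k : ℕ) : ℝ := if h : k < K then θ.2.2 ⟨k, h⟩ else 0

/-- `β_{p,k} = -β_{q,k}`, where `p = 3 - q`. -/
def betaP {K : ℕ} (θ : Param K) (k : ℕ) : ℝ := -betaQ θ k

/-- The ranges of the perturbation parameters. -/
def ranges (q K : ℕ) (eta1 : ℝ) : Set (Param K) :=
  {θ | ∀ k : Fin K,
    |θ.1 k| ≤ (1 - eta1) / 4 ∧
    θ.2.1 k ∈ Icc (1 : ℝ) 2 ∧
    θ.2.2 k ∈ (if q = 1 then Icc (0 : ℝ) (1 / 2) else Icc (-(1 / 2) : ℝ) 0) ∧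
    1 ≤ θ.2.1 k * (1 + θ.2.2 k)}

/-- The steps `s_k = (α_k ε)^{1/p}`. -/
def step {K : ℕ} (q : ℕ) (ε : ℝ) (θ : Param K) (k : ℕ) : ℝ :=
  (alpha θ k * ε) ^ (1 / (3 - (q : ℝ)))

/-- The iterates `x_k = s_0 + ⋯ + s_{k-1}`. -/
def iterate {K : ℕ} (q : ℕ) (ε : ℝ) (θ : Param K) (k : ℕ) : ℝ :=
  ∑ i ∈ Finset.range k, step q ε θ i

/-- The derivative values `f_k^{(j)}` for `j ∈ {1, 2} = {q, p}`. -/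
def derivData {K : ℕ} (q : ℕ) (ε : ℝ) (θ : Param K) (j k : ℕ) : ℝ :=
  if j = q then -(betaQ θ k) * (alpha θ k * ε) - alpha θ k * ε
  else -(betaP θ k) * (alpha θ k * ε) ^ ((q : ℝ) / (3 - (q : ℝ)))

/-- The function values `f_k^{(0)}`: the initial value is `3 · 2^{3/p}`, and the next value is the
value of the second-order Taylor polynomial at the step, plus the perturbation
`β_{0,k+1} s_k ^ 3`. -/
def valData {K : ℕ} (q : ℕ) (ε : ℝ) (θ : Param K) : ℕ → ℝ
  | 0 => 3 * (2 : ℝ) ^ (3 / (3 - (q : ℝ)))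
  | k + 1 => valData q ε θ k + derivData q ε θ 1 k * step q ε θ k
      + derivData q ε θ 2 k / 2 * step q ε θ k ^ 2 + beta0 θ (k + 1) * step q ε θ k ^ 3

/-- `f_k^{(j)}` for `j ∈ {0, 1, 2}`. -/
def data {K : ℕ} (q : ℕ) (ε : ℝ) (θ : Param K) (j k : ℕ) : ℝ :=
  if j = 0 then valData q ε θ k else derivData q ε θ j k

/-! ### Functions -/

/-- `f` is twice continuously differentiable and its second derivative is Lipschitz continuous
with constant `L`. -/
def IsSmooth (L : ℝ) (f : ℝ → ℝ) : Prop :=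
  ContDiff ℝ 2 f ∧
    ∀ x y, |iteratedDeriv 2 f x - iteratedDeriv 2 f y| ≤ L * |x - y|

/-- `f` is piecewise polynomial of degree at most five, with finitely many breakpoints: away from
a finite set it is locally (hence on each complementary interval) such a polynomial. -/
def IsPiecewiseQuintic (f : ℝ → ℝ) : Prop :=
  ∃ B : Finset ℝ, ∀ x ∉ B, ∃ P : Polynomial ℝ, P.natDegree ≤ 5 ∧ f =ᶠ[𝓝 x] fun y => P.eval y

/-- `ℝ →ᵇ ℝ` carries the uniform distance; we give it its Borel sets. -/
instance : MeasurableSpace (ℝ →ᵇ ℝ) := borel _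

instance : BorelSpace (ℝ →ᵇ ℝ) := ⟨rfl⟩

/-- Bounded `C²` functions with Lipschitz second derivative on which the algorithm, started at `0`
with accuracies `ε₁ = ε₂ = ε`, can take exactly `⌈ε^{-3/(3-q)}⌉` iterations, and this number of
evaluations of `f`, `f'` and `f''` (up to the extra one at the initial or final point). -/
def slowFunctions (c : Constants) (q : ℕ) (ε : ℝ) : Set (ℝ →ᵇ ℝ) :=
  {f | (∃ L, IsSmooth L f) ∧ ∃ x s σ : ℕ → ℝ,
    IsRun c q (fun _ => ε) f 0 (kEps q ε) x s σ ∧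
    objEvals (kEps q ε) = kEps q ε + 1 ∧
    gradEvals c f (kEps q ε) x s = kEps q ε + 1 ∧
    hessEvals c q f (kEps q ε) x s = kEps q ε + if q = 2 then 1 else 0}

end AR2

end

noncomputable section

namespace AR2

/-! ### Gluing functions along increasing breakpoints -/

/-! Both values of q reduce to one computation. Write s for s_k; there is a number a = `slope` in
[0, 3/2] with f'(x_k) = -a s² and f''(x_k) = (a - 1) s (`derivData_one`, `derivData_two`). With σ =
2 the model minus f(x_k) is -a s² d + (a - 1) s d²/2 + |d|³/3, whose global minimizer is s
(`cubic_model_le`), with predicted decrease (a + 1) s³/2. The prescribed value at x_{k+1} is off the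
Taylor prediction by β₀ s³, so ρ = 1 - 2β₀/(a + 1) ≥ η₁. Hence every iteration succeeds, σ may stay
at 2, and the termination test first passes at x_K, where both derivatives vanish (`isRun`).

The data are realized by quintic Hermite pieces, continued by constants to the left of -1 and to the
right of x_K. Since s_k^p = α_k ε with α_k in [1, 2], a step is at most twice the one before it, so
the Taylor defects of the data are O(s^(3-j)) in order j. This bounds the pieces up to their third
derivative independently of ε (`abs_hermite_eval_le`, `abs_piece_eval_le`). The values stay bounded
because each of the K steps changes them by O(s³) and K s³ ≤ 16 (`abs_valData_le`).

Conversely, the germs at the iterates determine the parameters: f' and f'' at x_k give s_k through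
(s - s')(a s + s') = 0, then a, then x_{k+1}, and the values give β₀ (`eq_of_eventuallyEq_spline`).
The parameter set is compact and the spline depends continuously on the parameters, so injectivity
yields both embeddings.

For the Hausdorff measure, the same recovery is made quantitative. On an open set of parameters for
which each piece contains six fixed nodes, the uniform distance of two splines controls the
difference of their parameters (`controlledOn_param`). The inverse map is then Lipschitz from part
of the family onto an open subset of a 3K-dimensional space, which forces positive measure
(`hausdorffMeasure_image_pos`). -/

/-- The function equal to `Q 0` up to `x 0`, to `Q i` between `x (i - 1)` and `x i`, and to `Q n`
after `x (n - 1)`. -/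
def glue (x : ℕ → ℝ) (Q : ℕ → ℝ → ℝ) : ℕ → ℝ → ℝ
  | 0 => Q 0
  | n + 1 => fun t => if t ≤ x n then glue x Q n t else Q (n + 1) t

section Glue

variable {x : ℕ → ℝ} {Q Q' : ℕ → ℝ → ℝ} {n : ℕ}

theorem glue_succ (t : ℝ) :
    glue x Q (n + 1) t = if t ≤ x n then glue x Q n t else Q (n + 1) t := rfl

/-- A tie at the last knot is resolved in favour of the left piece; matching values identify it with
the right one. The induction is needed because consecutive knots are allowed to coincide. -/
theorem glue_eq_of_ge (hx : ∀ i, i + 1 < n + 1 → x i ≤ x (i + 1))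
    (hQ : ∀ i < n + 1, Q i (x i) = Q (i + 1) (x i)) {t : ℝ} (ht : x n ≤ t) :
    glue x Q (n + 1) t = Q (n + 1) t := by
  induction n generalizing t with
  | zero =>
    rcases ht.eq_or_lt with rfl | h
    · simpa [glue] using hQ 0 (by simp)
    · simp [glue, h]
  | succ n ih =>
    rcases ht.eq_or_lt with rfl | h
    · have := ih (fun i hi => hx i (by omega)) (fun i hi => hQ i (by omega))
        (hx n (by omega))
      rw [glue_succ, if_pos le_rfl, this]
      exact hQ _ (by omega)
    · rw [glue_succ, if_neg (not_le.2 h)]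

theorem glue_self (hx : ∀ i < n, x i ≤ x (i + 1))
    (hQ : ∀ i < n, Q i (x i) = Q (i + 1) (x i)) : glue x Q n (x n) = Q n (x n) := by
  cases n with
  | zero => rfl
  | succ n => exact glue_eq_of_ge (fun i hi => hx i (by omega)) hQ (hx n (by omega))

theorem le_of_forall_le_succ (hx : ∀ i, i + 1 < n + 1 → x i ≤ x (i + 1)) {i j : ℕ} (hij : i ≤ j)
    (hj : j ≤ n) : x i ≤ x j := by
  induction j, hij using Nat.le_induction with
  | base => exact le_rfl
  | succ j hij ih => exact (ih (by omega)).trans (hx j (by omega))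

theorem glue_eq_of_le (hx : ∀ i, i + 1 < n → x i ≤ x (i + 1)) {t : ℝ} (ht : t ≤ x 0) :
    glue x Q n t = Q 0 t := by
  induction n with
  | zero => rfl
  | succ n ih =>
    rw [glue_succ, if_pos (ht.trans (le_of_forall_le_succ hx (Nat.zero_le n) le_rfl))]
    exact ih fun i hi => hx i (by omega)

theorem glue_eq_of_mem (hx : ∀ i, i + 1 < n → x i ≤ x (i + 1))
    (hQ : ∀ i < n, Q i (x i) = Q (i + 1) (x i)) {i : ℕ} (hi : i + 1 < n) {t : ℝ}
    (ht : t ∈ Icc (x i) (x (i + 1))) : glue x Q n t = Q (i + 1) t := by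
  induction n with
  | zero => omega
  | succ n ih =>
    have hle : x (i + 1) ≤ x n := le_of_forall_le_succ hx (by omega) le_rfl
    rw [glue_succ, if_pos (ht.2.trans hle)]
    rcases Nat.lt_or_ge (i + 1) n with h | h
    · exact ih (fun i hi => hx i (by omega)) (fun i hi => hQ i (by omega)) h
    · obtain rfl : n = i + 1 := by omega
      exact glue_eq_of_ge (fun j hj => hx j (by omega)) (fun j hj => hQ j (by omega)) ht.1

theorem glue_induction_le {p : ℝ → ℝ → Prop} (h0 : ∀ t ≤ x 0, p t (Q 0 t))
    (h : ∀ i < n, ∀ t ∈ Icc (x i) (x (i + 1)), p t (Q (i + 1) t)) {t : ℝ} (ht : t ≤ x n) :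
    p t (glue x Q n t) := by
  induction n generalizing t with
  | zero => exact h0 t ht
  | succ n ih =>
    rw [glue_succ]
    split_ifs with h'
    · exact ih (fun i hi => h i (by omega)) h'
    · exact h n (by omega) t ⟨(not_le.1 h').le, ht⟩

theorem glue_induction {p : ℝ → ℝ → Prop} (h0 : ∀ t ≤ x 0, p t (Q 0 t))
    (h : ∀ i < n, ∀ t ∈ Icc (x i) (x (i + 1)), p t (Q (i + 1) t))
    (hn : ∀ t, x n ≤ t → p t (Q (n + 1) t)) (t : ℝ) : p t (glue x Q (n + 1) t) := by
  rw [glue_succ]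
  split_ifs with h'
  · exact glue_induction_le h0 h h'
  · exact hn t (not_le.1 h').le

/-- At a knot the left and right derivatives are those of the two adjacent pieces, which agree
because `Q'` matches there as well as `Q`. -/
theorem hasDerivAt_glue (hx : ∀ i, i + 1 < n → x i ≤ x (i + 1))
    (hQ : ∀ i < n, Q i (x i) = Q (i + 1) (x i))
    (hQ' : ∀ i < n, Q' i (x i) = Q' (i + 1) (x i))
    (hd : ∀ i t, HasDerivAt (Q i) (Q' i t) t) (t : ℝ) :
    HasDerivAt (glue x Q n) (glue x Q' n t) t := by
  induction n generalizing t with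
  | zero => exact hd 0 t
  | succ n ih =>
    have ih := ih (fun i hi => hx i (by omega)) (fun i hi => hQ i (by omega))
      (fun i hi => hQ' i (by omega))
    have hs : glue x Q n (x n) = Q n (x n) :=
      glue_self (fun i hi => hx i (by omega)) (fun i hi => hQ i (by omega))
    have hs' : glue x Q' n (x n) = Q' n (x n) :=
      glue_self (fun i hi => hx i (by omega)) (fun i hi => hQ' i (by omega))
    rcases lt_trichotomy t (x n) with h | rfl | h
    · rw [glue_succ, if_pos h.le]
      refine (ih t).congr_of_eventuallyEq ?_
      filter_upwards [Iio_mem_nhds h] with y hy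
      rw [glue_succ, if_pos (le_of_lt hy)]
    · rw [glue_succ, if_pos le_rfl]
      have h1 : HasDerivWithinAt (glue x Q (n + 1)) (glue x Q' n (x n)) (Iic (x n)) (x n) :=
        (ih (x n)).hasDerivWithinAt.congr (fun y hy => by rw [glue_succ, if_pos (mem_Iic.1 hy)])
          (by rw [glue_succ, if_pos le_rfl])
      have h2 : HasDerivWithinAt (glue x Q (n + 1)) (glue x Q' n (x n)) (Ici (x n)) (x n) := by
        rw [hs', hQ' n (by omega)]
        exact (hd (n + 1) (x n)).hasDerivWithinAt.congr
          (fun y hy => glue_eq_of_ge hx hQ hy) (glue_eq_of_ge hx hQ le_rfl)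
      simpa using h1.union h2
    · rw [glue_succ, if_neg (not_le.2 h)]
      refine (hd (n + 1) t).congr_of_eventuallyEq ?_
      filter_upwards [Ioi_mem_nhds h] with y hy
      rw [glue_succ, if_neg (not_le.2 hy)]

theorem glue_eventuallyEq {t : ℝ} (ht : ∀ i < n, t ≠ x i) :
    ∃ i ≤ n, glue x Q n =ᶠ[𝓝 t] Q i := by
  induction n with
  | zero => exact ⟨0, le_rfl, EventuallyEq.rfl⟩
  | succ n ih =>
    rcases (ht n (by omega)).lt_or_gt with h | h
    · obtain ⟨i, hi, h'⟩ := ih fun i hi => ht i (by omega)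
      refine ⟨i, by omega, ?_⟩
      filter_upwards [Iio_mem_nhds h, h'] with y hy hy'
      rw [glue_succ, if_pos (le_of_lt hy), hy']
    · refine ⟨n + 1, le_rfl, ?_⟩
      filter_upwards [Ioi_mem_nhds h] with y hy
      rw [glue_succ, if_neg (not_le.2 hy)]

/-- For s ≤ a ≤ t one has |s - t| = |s - a| + |a - t|, so passing through a keeps the same constant
L. -/
theorem abs_sub_le_of_le_of_ge {g : ℝ → ℝ} {L a : ℝ} {S : Set ℝ}
    (h1 : ∀ s ≤ a, ∀ t ≤ a, |g s - g t| ≤ L * |s - t|)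
    (h2 : ∀ s ∈ S, a ≤ s → ∀ t ∈ S, a ≤ t → |g s - g t| ≤ L * |s - t|)
    (haS : a ∈ S) {s t : ℝ} (hs : s ∈ S ∨ s ≤ a) (ht : t ∈ S ∨ t ≤ a) :
    |g s - g t| ≤ L * |s - t| := by
  wlog hst : s ≤ t generalizing s t
  · rw [abs_sub_comm, abs_sub_comm s t]
    exact this ht hs (not_le.1 hst).le
  rcases le_total t a with hta | hta
  · exact h1 s (hst.trans hta) t hta
  have htS : t ∈ S := ht.elim id fun h => le_antisymm h hta ▸ haS
  rcases le_total s a with hsa | hsa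
  · have e1 := h1 s hsa a le_rfl
    have e2 := h2 a haS le_rfl t htS hta
    rw [abs_of_nonpos (sub_nonpos.2 hsa)] at e1
    rw [abs_of_nonpos (sub_nonpos.2 hta)] at e2
    rw [abs_of_nonpos (sub_nonpos.2 hst)]
    linarith [abs_sub_le (g s) (g a) (g t)]
  · have hsS : s ∈ S := hs.elim id fun h => le_antisymm h hsa ▸ haS
    exact h2 s hsS hsa t htS hta

theorem glue_lipschitz_le {L : ℝ} (hx : ∀ i < n, x i ≤ x (i + 1))
    (hQ : ∀ i < n, Q i (x i) = Q (i + 1) (x i))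
    (h0 : ∀ s ≤ x 0, ∀ t ≤ x 0, |Q 0 s - Q 0 t| ≤ L * |s - t|)
    (h : ∀ i < n, ∀ s ∈ Icc (x i) (x (i + 1)), ∀ t ∈ Icc (x i) (x (i + 1)),
      |Q (i + 1) s - Q (i + 1) t| ≤ L * |s - t|) :
    ∀ s ≤ x n, ∀ t ≤ x n, |glue x Q n s - glue x Q n t| ≤ L * |s - t| := by
  induction n with
  | zero => exact h0
  | succ n ih =>
    have ih := ih (fun i hi => hx i (by omega)) (fun i hi => hQ i (by omega))
      (fun i hi => h i (by omega))
    have hg : ∀ s, x n ≤ s → glue x Q (n + 1) s = Q (n + 1) s := fun s hs =>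
      glue_eq_of_ge (fun i hi => hx i (by omega)) hQ hs
    intro s hs t ht
    refine abs_sub_le_of_le_of_ge (a := x n) (S := Iic (x (n + 1))) ?_ ?_ (hx n (by omega))
      (Or.inl hs) (Or.inl ht)
    · intro s hs t ht
      rw [glue_succ, if_pos hs, glue_succ, if_pos ht]
      exact ih s hs t ht
    · intro s hs hs' t ht ht'
      rw [hg s hs', hg t ht']
      exact h n (by omega) s ⟨hs', hs⟩ t ⟨ht', ht⟩

theorem glue_lipschitz {L : ℝ} (hx : ∀ i < n, x i ≤ x (i + 1))
    (hQ : ∀ i < n + 1, Q i (x i) = Q (i + 1) (x i))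
    (h0 : ∀ s ≤ x 0, ∀ t ≤ x 0, |Q 0 s - Q 0 t| ≤ L * |s - t|)
    (h : ∀ i < n, ∀ s ∈ Icc (x i) (x (i + 1)), ∀ t ∈ Icc (x i) (x (i + 1)),
      |Q (i + 1) s - Q (i + 1) t| ≤ L * |s - t|)
    (hn : ∀ s, x n ≤ s → ∀ t, x n ≤ t → |Q (n + 1) s - Q (n + 1) t| ≤ L * |s - t|)
    (s t : ℝ) : |glue x Q (n + 1) s - glue x Q (n + 1) t| ≤ L * |s - t| := by
  have hg : ∀ s, x n ≤ s → glue x Q (n + 1) s = Q (n + 1) s := fun s hs =>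
    glue_eq_of_ge (fun i hi => hx i (by omega)) hQ hs
  refine abs_sub_le_of_le_of_ge (a := x n) (S := univ) ?_ ?_ (mem_univ _)
    (Or.inl (mem_univ _)) (Or.inl (mem_univ _))
  · intro s hs t ht
    rw [glue_succ, if_pos hs, glue_succ, if_pos ht]
    exact glue_lipschitz_le hx (fun i hi => hQ i (by omega)) h0 h s hs t ht
  · intro s _ hs t _ ht
    rw [hg s hs, hg t ht]
    exact hn s hs t ht

/-- The breakpoints move with the parameter; joint continuity survives because the two branches
agree on the whole moving interface t = x θ n. -/
theorem continuous_glue {T : Type*} [TopologicalSpace T] {x : T → ℕ → ℝ}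
    {Q : T → ℕ → ℝ → ℝ} (hx : ∀ i < n, Continuous fun θ => x θ i)
    (hle : ∀ θ, ∀ i, i + 1 < n → x θ i ≤ x θ (i + 1))
    (hQ : ∀ i ≤ n, Continuous fun z : T × ℝ => Q z.1 i z.2)
    (hm : ∀ θ, ∀ i < n, Q θ i (x θ i) = Q θ (i + 1) (x θ i)) :
    Continuous fun z : T × ℝ => glue (x z.1) (Q z.1) n z.2 := by
  induction n with
  | zero => exact hQ 0 le_rfl
  | succ n ih =>
    refine Continuous.if_le (ih (fun i hi => hx i (by omega)) (fun θ i hi => hle θ i (by omega))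
      (fun i hi => hQ i (by omega)) (fun θ i hi => hm θ i (by omega))) (hQ (n + 1) le_rfl)
      continuous_snd ((hx n (by omega)).comp continuous_fst) ?_
    rintro ⟨θ, t⟩ (h : t = x θ n)
    subst h
    exact (glue_self (fun i hi => hle θ i (by omega)) (fun i hi => hm θ i (by omega))).trans
      (hm θ n (by omega))

end Glue

/-! ### Quintic Hermite interpolation -/

open Polynomial in
/-- The polynomial of degree at most five with value and first two derivatives `a 0`, `a 1`, `a 2`
at `0` and `b 0`, `b 1`, `b 2` at `h`. The scaled defects of the second-order Taylor polynomial
are `E₀`, `E₁` and `E₂`. -/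
def hermite (h : ℝ) (a b : ℕ → ℝ) : ℝ[X] :=
  let E₀ := (b 0 - a 0 - a 1 * h - a 2 / 2 * h ^ 2) / h ^ 3
  let E₁ := (b 1 - a 1 - a 2 * h) / h ^ 2
  let E₂ := (b 2 - a 2) / h
  C (a 0) + C (a 1) * X + C (a 2 / 2) * X ^ 2 + C (10 * E₀ - 4 * E₁ + E₂ / 2) * X ^ 3
    + C ((-15 * E₀ + 7 * E₁ - E₂) / h) * X ^ 4 + C ((6 * E₀ - 3 * E₁ + E₂ / 2) / h ^ 2) * X ^ 5

section Hermite

variable {h : ℝ} {a b : ℕ → ℝ}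

theorem natDegree_hermite_le : (hermite h a b).natDegree ≤ 5 := by
  have key : ∀ c₀ c₁ c₂ c₃ c₄ c₅ : ℝ, (Polynomial.C c₀ + Polynomial.C c₁ * Polynomial.X
      + Polynomial.C c₂ * Polynomial.X ^ 2 + Polynomial.C c₃ * Polynomial.X ^ 3
      + Polynomial.C c₄ * Polynomial.X ^ 4 + Polynomial.C c₅ * Polynomial.X ^ 5).natDegree ≤ 5 := by
    intros
    compute_degree
  exact key _ _ _ _ _ _

theorem hermite_eval_zero {j : ℕ} (hj : j ≤ 2) :
    (Polynomial.derivative^[j] (hermite h a b)).eval 0 = a j := by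
  interval_cases j <;> simp [hermite, Polynomial.derivative_pow]

theorem hermite_eval_self (hh : h ≠ 0) {j : ℕ} (hj : j ≤ 2) :
    (Polynomial.derivative^[j] (hermite h a b)).eval h = b j := by
  interval_cases j <;> simp [hermite, Polynomial.derivative_pow] <;> field_simp <;> ring

/-- In the variable v = u / h the j-th derivative becomes a combination of bounded numbers with
factors v^i h^k in [0, 1]. No negative power of h is left for j ≤ 3, so the bound is uniform in h.
Defects at most 7 give coefficients at most 102, 161 and 67; the largest sum, 6·102 + 24·161 + 60·67
for j = 3, is below 10000. -/
theorem abs_hermite_eval_le (h0 : 0 < h) (h1 : h ≤ 1) (a0 : |a 0| ≤ 48) (a1 : |a 1| ≤ 2)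
    (a2 : |a 2| ≤ 1) (e0 : |b 0 - a 0 - a 1 * h - a 2 / 2 * h ^ 2| ≤ 7 * h ^ 3)
    (e1 : |b 1 - a 1 - a 2 * h| ≤ 7 * h ^ 2) (e2 : |b 2 - a 2| ≤ 7 * h)
    {u : ℝ} (hu : u ∈ Icc 0 h) {j : ℕ} (hj : j ≤ 3) :
    |(Polynomial.derivative^[j] (hermite h a b)).eval u| ≤ 10000 := by
  set E₀ := (b 0 - a 0 - a 1 * h - a 2 / 2 * h ^ 2) / h ^ 3 with hE₀
  set E₁ := (b 1 - a 1 - a 2 * h) / h ^ 2 with hE₁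
  set E₂ := (b 2 - a 2) / h with hE₂
  have e0 : |E₀| ≤ 7 := by
    rw [hE₀, abs_div, abs_of_pos (pow_pos h0 3), div_le_iff₀ (by positivity)]; exact e0
  have e1 : |E₁| ≤ 7 := by
    rw [hE₁, abs_div, abs_of_pos (pow_pos h0 2), div_le_iff₀ (by positivity)]; exact e1
  have e2 : |E₂| ≤ 7 := by
    rw [hE₂, abs_div, abs_of_pos h0, div_le_iff₀ h0]; exact e2
  obtain ⟨v, hv, rfl⟩ : ∃ v ∈ Icc (0 : ℝ) 1, u = v * h :=
    ⟨u / h, ⟨div_nonneg hu.1 h0.le, (div_le_one h0).2 hu.2⟩, by field_simp⟩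
  set d₃ := 10 * E₀ - 4 * E₁ + E₂ / 2 with hd₃
  set d₄ := -15 * E₀ + 7 * E₁ - E₂ with hd₄
  set d₅ := 6 * E₀ - 3 * E₁ + E₂ / 2 with hd₅
  have f3 : |d₃| ≤ 102 := by
    rw [abs_le] at *; constructor <;> linarith
  have f4 : |d₄| ≤ 161 := by
    rw [abs_le] at *; constructor <;> linarith
  have f5 : |d₅| ≤ 67 := by
    rw [abs_le] at *; constructor <;> linarith
  have key : ∀ {c B m : ℝ}, |c| ≤ B → m ∈ Icc (0 : ℝ) 1 → |c * m| ≤ B := by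
    intro c B m hc hm
    rw [abs_mul, abs_of_nonneg hm.1]
    exact (mul_le_of_le_one_right (abs_nonneg c) hm.2).trans hc
  have hI : h ∈ Icc (0 : ℝ) 1 := ⟨h0.le, h1⟩
  have hp : ∀ i k : ℕ, v ^ i * h ^ k ∈ Icc (0 : ℝ) 1 := fun i k =>
    ⟨mul_nonneg (pow_nonneg hv.1 _) (pow_nonneg hI.1 _),
      mul_le_one₀ (pow_le_one₀ hv.1 hv.2) (pow_nonneg hI.1 _) (pow_le_one₀ hI.1 hI.2)⟩
  have hform : hermite h a b = Polynomial.C (a 0) + Polynomial.C (a 1) * Polynomial.X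
      + Polynomial.C (a 2 / 2) * Polynomial.X ^ 2 + Polynomial.C d₃ * Polynomial.X ^ 3
      + Polynomial.C (d₄ / h) * Polynomial.X ^ 4
      + Polynomial.C (d₅ / h ^ 2) * Polynomial.X ^ 5 := rfl
  have hh : h ≠ 0 := h0.ne'
  interval_cases j
  · have : (Polynomial.derivative^[0] (hermite h a b)).eval (v * h) = a 0 + a 1 * (v ^ 1 * h ^ 1)
        + a 2 * (v ^ 2 * h ^ 2) / 2 + d₃ * (v ^ 3 * h ^ 3) + d₄ * (v ^ 4 * h ^ 3)
        + d₅ * (v ^ 5 * h ^ 3) := by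
      rw [hform]; simp; field_simp
    rw [this]
    have := key a1 (hp 1 1); have := key a2 (hp 2 2); have := key f3 (hp 3 3)
    have := key f4 (hp 4 3); have := key f5 (hp 5 3)
    simp only [abs_le] at *; constructor <;> linarith
  · have : (Polynomial.derivative^[1] (hermite h a b)).eval (v * h) = a 1
        + a 2 * (v ^ 1 * h ^ 1) + 3 * (d₃ * (v ^ 2 * h ^ 2)) + 4 * (d₄ * (v ^ 3 * h ^ 2))
        + 5 * (d₅ * (v ^ 4 * h ^ 2)) := by
      rw [hform]; simp [Polynomial.derivative_pow]; field_simp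
    rw [this]
    have := key a2 (hp 1 1); have := key f3 (hp 2 2)
    have := key f4 (hp 3 2); have := key f5 (hp 4 2)
    simp only [abs_le] at *; constructor <;> linarith
  · have : (Polynomial.derivative^[2] (hermite h a b)).eval (v * h) = a 2
        + 6 * (d₃ * (v ^ 1 * h ^ 1)) + 12 * (d₄ * (v ^ 2 * h ^ 1))
        + 20 * (d₅ * (v ^ 3 * h ^ 1)) := by
      rw [hform]; simp [Polynomial.derivative_pow]; field_simp; ring
    rw [this]
    have := key f3 (hp 1 1); have := key f4 (hp 2 1); have := key f5 (hp 3 1)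
    simp only [abs_le] at *; constructor <;> linarith
  · have : (Polynomial.derivative^[3] (hermite h a b)).eval (v * h) = 6 * d₃
        + 24 * (d₄ * (v ^ 1 * h ^ 0)) + 60 * (d₅ * (v ^ 2 * h ^ 0)) := by
      rw [hform]; simp [Polynomial.derivative_pow]; field_simp; ring
    rw [this]
    have := key f4 (hp 1 0); have := key f5 (hp 2 0)
    simp only [abs_le] at *; constructor <;> linarith

end Hermite

theorem abs_sub_le_of_derivative_le {P : Polynomial ℝ} {L : ℝ} {S : Set ℝ} (hS : Convex ℝ S)
    (hP : ∀ t ∈ S, |P.derivative.eval t| ≤ L) {s t : ℝ} (hs : s ∈ S) (ht : t ∈ S) :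
    |P.eval s - P.eval t| ≤ L * |s - t| := by
  have := hS.norm_image_sub_le_of_norm_hasDerivWithin_le (f := fun t => P.eval t)
    (f' := fun t => P.derivative.eval t) (fun y _ => (P.hasDerivAt y).hasDerivWithinAt) hP ht hs
  simpa using this

/-! ### Estimates for the perturbed data -/

/-- The number `a` with `f'(x_k) = -a s_k²` and `f''(x_k) = (a - 1) s_k`. -/
def slope {K : ℕ} (q : ℕ) (θ : Param K) (k : ℕ) : ℝ :=
  if q = 1 then 1 + betaQ θ k else -betaQ θ k

section Data

variable {q K : ℕ} {ε η : ℝ} {θ : Param K}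

theorem alpha_of_ge {k : ℕ} (hk : K ≤ k) : alpha θ k = 0 := by simp [alpha, hk.not_gt]

theorem betaQ_of_ge {k : ℕ} (hk : K ≤ k) : betaQ θ k = 0 := by simp [betaQ, hk.not_gt]

theorem alpha_mem (hθ : θ ∈ ranges q K η) {k : ℕ} (hk : k < K) : alpha θ k ∈ Icc (1 : ℝ) 2 := by
  simpa [alpha, hk] using (hθ ⟨k, hk⟩).2.1

theorem alpha_nonneg (hθ : θ ∈ ranges q K η) (k : ℕ) : 0 ≤ alpha θ k := by
  rcases lt_or_ge k K with h | h
  · exact zero_le_one.trans (alpha_mem hθ h).1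
  · exact (alpha_of_ge h).ge

theorem alpha_le_two (hθ : θ ∈ ranges q K η) (k : ℕ) : alpha θ k ≤ 2 := by
  rcases lt_or_ge k K with h | h
  · exact (alpha_mem hθ h).2
  · simp [alpha_of_ge h]

theorem betaQ_mem (hθ : θ ∈ ranges q K η) (k : ℕ) :
    betaQ θ k ∈ if q = 1 then Icc (0 : ℝ) (1 / 2) else Icc (-(1 / 2) : ℝ) 0 := by
  rcases lt_or_ge k K with h | h
  · simpa [betaQ, h] using (hθ ⟨k, h⟩).2.2.1
  · rw [betaQ_of_ge h]
    split_ifs <;> norm_num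

theorem one_le_alpha_mul (hθ : θ ∈ ranges q K η) {k : ℕ} (hk : k < K) :
    1 ≤ alpha θ k * (1 + betaQ θ k) := by
  simpa [alpha, betaQ, hk] using (hθ ⟨k, hk⟩).2.2.2

theorem abs_beta0_le (hη : η ∈ Ioo 0 1) (hθ : θ ∈ ranges q K η) (k : ℕ) :
    |beta0 θ k| ≤ (1 - η) / 4 := by
  have h0 : 0 ≤ (1 - η) / 4 := by linarith [hη.2]
  cases k with
  | zero => simpa [beta0] using h0
  | succ k =>
    rcases lt_or_ge k K with h | h
    · simpa [beta0, h] using (hθ ⟨k, h⟩).1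
    · simpa [beta0, h.not_gt] using h0

theorem slope_mem (hθ : θ ∈ ranges q K η) (k : ℕ) : slope q θ k ∈ Icc (0 : ℝ) (3 / 2) := by
  have := betaQ_mem hθ k
  unfold slope
  split_ifs at this ⊢ <;> constructor <;> linarith [this.1, this.2]

/-- Trades the real powers in the data for natural powers of the step, since p = 3 - q is 1 or 2. -/
theorem alpha_mul_eq (hq : q = 1 ∨ q = 2) (hε : 0 < ε) (hθ : θ ∈ ranges q K η) (k : ℕ) :
    alpha θ k * ε = step q ε θ k ^ (3 - q) := by
  have h0 : 0 ≤ alpha θ k * ε := mul_nonneg (alpha_nonneg hθ k) hε.le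
  rcases hq with rfl | rfl
  · rw [step, ← Real.rpow_natCast, ← Real.rpow_mul h0]
    norm_num
  · norm_num [step]

theorem step_nonneg (hε : 0 < ε) (hθ : θ ∈ ranges q K η) (k : ℕ) : 0 ≤ step q ε θ k :=
  Real.rpow_nonneg (mul_nonneg (alpha_nonneg hθ k) hε.le) _

theorem step_pos (hε : 0 < ε) (hθ : θ ∈ ranges q K η) {k : ℕ} (hk : k < K) :
    0 < step q ε θ k :=
  Real.rpow_pos_of_pos (mul_pos (zero_lt_one.trans_le (alpha_mem hθ hk).1) hε) _

theorem step_of_ge (hq : q = 1 ∨ q = 2) {k : ℕ} (hk : K ≤ k) : step q ε θ k = 0 := by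
  rw [step, alpha_of_ge hk, zero_mul, Real.zero_rpow]
  rcases hq with rfl | rfl <;> norm_num

theorem step_le_one (hq : q = 1 ∨ q = 2) (hε : 0 < ε) (hε' : ε ≤ 1 / 4)
    (hθ : θ ∈ ranges q K η) (k : ℕ) : step q ε θ k ≤ 1 := by
  refine Real.rpow_le_one (mul_nonneg (alpha_nonneg hθ k) hε.le) ?_ ?_
  · nlinarith [alpha_le_two hθ k]
  · rcases hq with rfl | rfl <;> norm_num

/-- The powers s^p = α ε differ by a factor of at most two, and p ≥ 1. The index l may lie beyond
the last step, where the step is zero. -/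
theorem step_succ_le (hq : q = 1 ∨ q = 2) (hε : 0 < ε) (hθ : θ ∈ ranges q K η) {k : ℕ}
    (hk : k < K) (l : ℕ) : step q ε θ l ≤ 2 * step q ε θ k := by
  have h1 := alpha_mul_eq hq hε hθ l
  have h2 := alpha_mul_eq hq hε hθ k
  have h3 : alpha θ l * ε ≤ 2 * (alpha θ k * ε) := by
    nlinarith [alpha_le_two hθ l, (alpha_mem hθ hk).1]
  have := step_nonneg hε hθ (q := q) k
  rw [h1, h2] at h3
  rcases hq with rfl | rfl
  · exact abs_le_of_sq_le_sq' (by norm_num at h3 ⊢; nlinarith) (by positivity) |>.2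
  · simpa using h3

theorem derivData_one (hq : q = 1 ∨ q = 2) (hε : 0 < ε) (hθ : θ ∈ ranges q K η) (k : ℕ) :
    derivData q ε θ 1 k = -slope q θ k * step q ε θ k ^ 2 := by
  have h := alpha_mul_eq hq hε hθ k
  rcases hq with rfl | rfl
  · rw [derivData, h]
    simp [slope]
    ring
  · have : (alpha θ k * ε) ^ ((2 : ℕ) / (3 - (2 : ℕ) : ℝ)) = step 2 ε θ k ^ 2 := by
      rw [h]
      norm_num
    rw [derivData, this]
    simp [slope, betaP]

theorem derivData_two (hq : q = 1 ∨ q = 2) (hε : 0 < ε) (hθ : θ ∈ ranges q K η) (k : ℕ) :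
    derivData q ε θ 2 k = (slope q θ k - 1) * step q ε θ k := by
  have h := alpha_mul_eq hq hε hθ k
  rcases hq with rfl | rfl
  · have : (alpha θ k * ε) ^ ((1 : ℕ) / (3 - (1 : ℕ) : ℝ)) = step 1 ε θ k := by
      simp [step]
    rw [derivData, this]
    simp [slope, betaP]
  · rw [derivData, h]
    simp [slope]
    ring

/-- The Taylor increment is -a s³ + (a - 1) s³/2 = -(a + 1) s³/2. -/
theorem valData_succ (hq : q = 1 ∨ q = 2) (hε : 0 < ε) (hθ : θ ∈ ranges q K η) (k : ℕ) :
    valData q ε θ (k + 1) = valData q ε θ k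
      + (beta0 θ (k + 1) - (slope q θ k + 1) / 2) * step q ε θ k ^ 3 := by
  rw [valData, derivData_one hq hε hθ, derivData_two hq hε hθ]
  ring

/-- With w = ε^(1/p), the step is at most 2w while K ≤ w⁻³ + 1: the iteration count is of the order
of the inverse cubed step. -/
theorem step_pow_three_mul_le (hq : q = 1 ∨ q = 2) (hε : 0 < ε) (hε' : ε ≤ 1 / 4)
    (hθ : θ ∈ ranges q K η) (k : ℕ) : step q ε θ k ^ 3 * kEps q ε ≤ 16 := by
  have hp : (0 : ℝ) < 3 - q := by rcases hq with rfl | rfl <;> norm_num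
  set w : ℝ := ε ^ (1 / (3 - (q : ℝ))) with hw
  have w0 : 0 < w := Real.rpow_pos_of_pos hε _
  have w1 : w ≤ 1 := Real.rpow_le_one hε.le (by linarith) (by positivity)
  have hs : step q ε θ k ≤ 2 * w := by
    rw [step, Real.mul_rpow (alpha_nonneg hθ k) hε.le]
    gcongr
    calc alpha θ k ^ (1 / (3 - (q : ℝ))) ≤ 2 ^ (1 / (3 - (q : ℝ))) :=
          Real.rpow_le_rpow (alpha_nonneg hθ k) (alpha_le_two hθ k) (by positivity)
      _ ≤ 2 ^ (1 : ℝ) := Real.rpow_le_rpow_of_exponent_le (by norm_num)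
          (by rcases hq with rfl | rfl <;> norm_num)
      _ = 2 := Real.rpow_one 2
  have hK : (kEps q ε : ℝ) ≤ (w ^ 3)⁻¹ + 1 := by
    have : ε ^ (-(3 / (3 - (q : ℝ)))) = (w ^ 3)⁻¹ := by
      rw [Real.rpow_neg hε.le, hw, ← Real.rpow_natCast, ← Real.rpow_mul hε.le]
      congr 2
      push_cast
      ring
    rw [kEps, this]
    exact (Nat.ceil_lt_add_one (by positivity)).le
  have h0 := step_nonneg hε hθ (q := q) k
  calc step q ε θ k ^ 3 * kEps q ε ≤ (2 * w) ^ 3 * ((w ^ 3)⁻¹ + 1) := by gcongr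
    _ = 8 * (1 + w ^ 3) := by field_simp; ring
    _ ≤ 8 * (1 + 1) := by gcongr; exact pow_le_one₀ w0.le w1
    _ = 16 := by norm_num

/-- The initial value is at most 24, and each of the K changes is at most (3/2)·16/K = 24/K. -/
theorem abs_valData_le (hq : q = 1 ∨ q = 2) (hε : 0 < ε) (hε' : ε ≤ 1 / 4) (hη : η ∈ Ioo 0 1)
    (hK : K = kEps q ε) (hθ : θ ∈ ranges q K η) {k : ℕ} (hk : k ≤ K) :
    |valData q ε θ k| ≤ 48 := by
  have h0 : |valData q ε θ 0| ≤ 24 := by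
    have h2 : (0 : ℝ) ≤ 2 ^ (3 / (3 - (q : ℝ))) := by positivity
    rw [valData, abs_of_nonneg (by positivity)]
    have : (2 : ℝ) ^ (3 / (3 - (q : ℝ))) ≤ 2 ^ (3 : ℝ) :=
      Real.rpow_le_rpow_of_exponent_le (by norm_num) (by rcases hq with rfl | rfl <;> norm_num)
    norm_num at this
    linarith
  have hstep : ∀ i, |valData q ε θ (i + 1) - valData q ε θ i| * K ≤ 24 := by
    intro i
    have h3 := step_pow_three_mul_le hq hε hε' hθ i
    have hc : |beta0 θ (i + 1) - (slope q θ i + 1) / 2| ≤ 3 / 2 := by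
      have h1 := abs_le.1 (abs_beta0_le hη hθ (i + 1))
      have h2 := slope_mem hθ i
      rw [abs_le]
      constructor <;> linarith [h1.1, h1.2, h2.1, h2.2, hη.1]
    rw [← hK] at h3
    rw [valData_succ hq hε hθ, add_sub_cancel_left, abs_mul,
      abs_of_nonneg (pow_nonneg (step_nonneg hε hθ i) 3), mul_assoc]
    calc _ ≤ 3 / 2 * (16 : ℝ) := by
          gcongr
          exact mul_nonneg (pow_nonneg (step_nonneg hε hθ i) 3) (Nat.cast_nonneg _)
      _ = 24 := by norm_num
  -- Everything is kept multiplied by K, so that K = 0 needs attention only at the end.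
  have hind : ∀ i, |valData q ε θ i| * K ≤ 24 * K + 24 * i := by
    intro i
    induction i with
    | zero => simpa using mul_le_mul_of_nonneg_right h0 (Nat.cast_nonneg K)
    | succ i ih =>
      have h1 := hstep i
      have h2 : |valData q ε θ (i + 1)| ≤
          |valData q ε θ i| + |valData q ε θ (i + 1) - valData q ε θ i| := by
        simpa using abs_add_le (valData q ε θ i) (valData q ε θ (i + 1) - valData q ε θ i)
      have h3 := mul_le_mul_of_nonneg_right h2 (Nat.cast_nonneg (α := ℝ) K)
      push_cast
      linarith
  rcases Nat.eq_zero_or_pos K with h | h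
  · obtain rfl : k = 0 := by omega
    linarith
  · have hK0 : (0 : ℝ) < K := by exact_mod_cast h
    have hkK : (k : ℝ) ≤ K := by exact_mod_cast hk
    refine le_of_mul_le_mul_right ?_ hK0
    linarith [hind k]

theorem iterate_succ (k : ℕ) : iterate q ε θ (k + 1) = iterate q ε θ k + step q ε θ k := by
  simp [iterate, Finset.sum_range_succ]

theorem iterate_le (hq : q = 1 ∨ q = 2) (hε : 0 < ε) (hε' : ε ≤ 1 / 4)
    (hθ : θ ∈ ranges q K η) (k : ℕ) : iterate q ε θ k ≤ k := by
  simpa [iterate] using Finset.sum_le_card_nsmul (Finset.range k) (step q ε θ) 1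
    fun i _ => step_le_one hq hε hε' hθ i

theorem iterate_nonneg (hε : 0 < ε) (hθ : θ ∈ ranges q K η) (k : ℕ) : 0 ≤ iterate q ε θ k :=
  Finset.sum_nonneg fun i _ => step_nonneg hε hθ i

end Data

/-! ### The interpolating spline -/

section Spline

variable {q K : ℕ} {ε η : ℝ} {θ : Param K}

/-- The breakpoints `-1, x_0, x_1, …`. -/
def knots (q : ℕ) (ε : ℝ) (θ : Param K) : ℕ → ℝ
  | 0 => -1
  | k + 1 => iterate q ε θ k

/-- The value and first two derivatives to be taken at the breakpoints. -/
def knotData (q : ℕ) (ε : ℝ) (θ : Param K) : ℕ → ℕ → ℝ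
  | 0, j => if j = 0 then valData q ε θ 0 else 0
  | k + 1, j => data q ε θ j k

/-- The polynomial pieces: constant, quintic between consecutive breakpoints, constant. -/
def piece (q : ℕ) (ε : ℝ) (θ : Param K) : ℕ → Polynomial ℝ
  | 0 => Polynomial.C (valData q ε θ 0)
  | k + 1 => if k ≤ K then
      (hermite (knots q ε θ (k + 1) - knots q ε θ k) (knotData q ε θ k)
        (knotData q ε θ (k + 1))).comp (Polynomial.X - Polynomial.C (knots q ε θ k))
    else Polynomial.C (valData q ε θ K)

/-- The `j`-th derivative of the spline. -/
def splineDeriv (q : ℕ) (ε : ℝ) (θ : Param K) (j : ℕ) : ℝ → ℝ :=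
  glue (knots q ε θ) (fun n t => (Polynomial.derivative^[j] (piece q ε θ n)).eval t) (K + 2)

/-- The piecewise quintic interpolant of the perturbed data. -/
def spline (q : ℕ) (ε : ℝ) (θ : Param K) : ℝ → ℝ := splineDeriv q ε θ 0

theorem iterate_derivative_comp_X_sub_C (P : Polynomial ℝ) (a : ℝ) (j : ℕ) :
    Polynomial.derivative^[j] (P.comp (Polynomial.X - Polynomial.C a))
      = (Polynomial.derivative^[j] P).comp (Polynomial.X - Polynomial.C a) := by
  induction j with
  | zero => rfl
  | succ j ih =>
    rw [Function.iterate_succ_apply', ih, Function.iterate_succ_apply', Polynomial.derivative_comp]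
    simp

theorem piece_succ_eval {k : ℕ} (hk : k ≤ K) (j : ℕ) (t : ℝ) :
    (Polynomial.derivative^[j] (piece q ε θ (k + 1))).eval t
      = (Polynomial.derivative^[j] (hermite (knots q ε θ (k + 1) - knots q ε θ k)
          (knotData q ε θ k) (knotData q ε θ (k + 1)))).eval (t - knots q ε θ k) := by
  rw [piece, if_pos hk, iterate_derivative_comp_X_sub_C]
  simp

theorem natDegree_piece_le (n : ℕ) : (piece q ε θ n).natDegree ≤ 5 := by
  cases n with
  | zero => simp [piece]
  | succ k =>
    rw [piece]
    split_ifs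
    · rw [Polynomial.natDegree_comp, Polynomial.natDegree_X_sub_C, mul_one]
      exact natDegree_hermite_le
    · simp

theorem knots_lt (hε : 0 < ε) (hθ : θ ∈ ranges q K η) {k : ℕ} (hk : k ≤ K) :
    knots q ε θ k < knots q ε θ (k + 1) := by
  cases k with
  | zero => simp [knots, iterate]
  | succ k =>
    rw [knots, knots, iterate_succ]
    linarith [step_pos hε hθ (show k < K by omega)]

theorem knots_sub_le (hq : q = 1 ∨ q = 2) (hε : 0 < ε) (hε' : ε ≤ 1 / 4)
    (hθ : θ ∈ ranges q K η) (k : ℕ) : knots q ε θ (k + 1) - knots q ε θ k ≤ 1 := by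
  cases k with
  | zero => simp [knots, iterate]
  | succ k =>
    rw [knots, knots, iterate_succ]
    linarith [step_le_one hq hε hε' hθ k]

theorem abs_derivData_one_le (hq : q = 1 ∨ q = 2) (hε : 0 < ε) (hε' : ε ≤ 1 / 4)
    (hθ : θ ∈ ranges q K η) (k : ℕ) : |derivData q ε θ 1 k| ≤ 2 := by
  have h1 := slope_mem hθ k
  have h2 := pow_le_one₀ (n := 2) (step_nonneg hε hθ k) (step_le_one hq hε hε' hθ k)
  rw [derivData_one hq hε hθ, abs_mul, abs_neg, abs_of_nonneg h1.1, abs_of_nonneg (sq_nonneg _)]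
  nlinarith [h1.1, h1.2, sq_nonneg (step q ε θ k)]

theorem abs_derivData_two_le (hq : q = 1 ∨ q = 2) (hε : 0 < ε) (hε' : ε ≤ 1 / 4)
    (hθ : θ ∈ ranges q K η) (k : ℕ) : |derivData q ε θ 2 k| ≤ 1 := by
  have h1 := slope_mem hθ k
  have h2 : |slope q θ k - 1| ≤ 1 := by rw [abs_le]; constructor <;> linarith [h1.1, h1.2]
  rw [derivData_two hq hε hθ, abs_mul, abs_of_nonneg (step_nonneg hε hθ k)]
  exact mul_le_one₀ h2 (step_nonneg hε hθ k) (step_le_one hq hε hε' hθ k)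

theorem derivData_self (hq : q = 1 ∨ q = 2) (hε : 0 < ε) (hθ : θ ∈ ranges q K η)
    {j : ℕ} (hj : j = 1 ∨ j = 2) : derivData q ε θ j K = 0 := by
  rcases hj with rfl | rfl
  · rw [derivData_one hq hε hθ, step_of_ge hq le_rfl]; simp
  · rw [derivData_two hq hε hθ, step_of_ge hq le_rfl]; simp

/-- Only the Taylor defects of the data need checking; they are O(h^(3-j)) because the next step is
at most twice the current one. -/
theorem abs_piece_eval_le (hq : q = 1 ∨ q = 2) (hε : 0 < ε) (hε' : ε ≤ 1 / 4) (hη : η ∈ Ioo 0 1)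
    (hK : K = kEps q ε) (hθ : θ ∈ ranges q K η) {k : ℕ} (hk : k ≤ K) {j : ℕ} (hj : j ≤ 3) {t : ℝ}
    (ht : t ∈ Icc (knots q ε θ k) (knots q ε θ (k + 1))) :
    |(Polynomial.derivative^[j] (piece q ε θ (k + 1))).eval t| ≤ 10000 := by
  rw [piece_succ_eval hk]
  have hu : t - knots q ε θ k ∈ Icc 0 (knots q ε θ (k + 1) - knots q ε θ k) :=
    ⟨sub_nonneg.2 ht.1, sub_le_sub_right ht.2 _⟩
  have hpos := sub_pos.2 (knots_lt (q := q) hε hθ hk)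
  have hle := knots_sub_le hq hε hε' hθ k
  have hd1 := abs_derivData_one_le hq hε hε' hθ
  have hd2 := abs_derivData_two_le hq hε hε' hθ
  have hv := fun {k} (hk : k ≤ K) => abs_valData_le hq hε hε' hη hK hθ hk
  cases k with
  | zero =>
    -- The lead-in interval [-1, 0] has length one and starts from constant data, so its defects are
    -- just the data at 0.
    have h1 : knots q ε θ (0 + 1) - knots q ε θ 0 = 1 := by simp [knots, iterate]
    rw [h1] at hu ⊢
    refine abs_hermite_eval_le one_pos le_rfl ?_ ?_ ?_ ?_ ?_ ?_ hu hj
    · simpa [knotData] using hv hk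
    · simp [knotData]
    · simp [knotData]
    · simp [knotData, data]
    · simpa [knotData, data] using (hd1 0).trans (by norm_num)
    · simpa [knotData, data] using (hd2 0).trans (by norm_num)
  | succ k =>
    have h1 : knots q ε θ (k + 1 + 1) - knots q ε θ (k + 1) = step q ε θ k := by
      rw [knots, knots, iterate_succ]; ring
    rw [h1] at hu hpos hle ⊢
    have hs := step_succ_le hq hε hθ (show k < K by omega) (k + 1)
    have hs0 := step_nonneg hε hθ (q := q) (k + 1)
    have ha := slope_mem hθ k
    have ha' := slope_mem hθ (k + 1)
    refine abs_hermite_eval_le hpos hle ?_ ?_ ?_ ?_ ?_ ?_ hu hj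
    · simpa [knotData, data] using hv (by omega)
    · simpa [knotData, data] using hd1 k
    · simpa [knotData, data] using hd2 k
    · have : valData q ε θ (k + 1) - valData q ε θ k - derivData q ε θ 1 k * step q ε θ k
          - derivData q ε θ 2 k / 2 * step q ε θ k ^ 2 = beta0 θ (k + 1) * step q ε θ k ^ 3 := by
        rw [valData]; ring
      simp only [knotData, data, if_pos, if_neg one_ne_zero, if_neg two_ne_zero, this]
      rw [abs_mul, abs_of_pos (pow_pos hpos 3)]
      have := abs_beta0_le hη hθ (k + 1)
      gcongr
      linarith [hη.1]
    · simp only [knotData, data, if_neg one_ne_zero, if_neg two_ne_zero]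
      rw [derivData_one hq hε hθ, derivData_one hq hε hθ, derivData_two hq hε hθ, abs_le]
      -- With a', s' the next slope and step, the first-order defect simplifies to s² - a' s'², and
      -- a' s'² ≤ (3/2)·4 s².
      have h4 : step q ε θ (k + 1) ^ 2 ≤ 4 * step q ε θ k ^ 2 := by nlinarith
      have h5 : slope q θ (k + 1) * step q ε θ (k + 1) ^ 2 ≤ 3 / 2 * (4 * step q ε θ k ^ 2) :=
        mul_le_mul ha'.2 h4 (sq_nonneg _) (by norm_num)
      have h6 := mul_nonneg ha'.1 (sq_nonneg (step q ε θ (k + 1)))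
      constructor <;> nlinarith
    · simp only [knotData, data, if_neg two_ne_zero]
      rw [derivData_two hq hε hθ, derivData_two hq hε hθ, abs_le]
      have h5 : |slope q θ (k + 1) - 1| ≤ 1 := by
        rw [abs_le]; constructor <;> linarith [ha'.1, ha'.2]
      have h6 : |slope q θ k - 1| ≤ 1 := by
        rw [abs_le]; constructor <;> linarith [ha.1, ha.2]
      rw [abs_le] at h5 h6
      constructor <;> nlinarith

theorem piece_eval_left (hε : 0 < ε) (hq : q = 1 ∨ q = 2) (hθ : θ ∈ ranges q K η) {k : ℕ}
    (hk : k ≤ K + 1) {j : ℕ} (hj : j ≤ 2) :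
    (Polynomial.derivative^[j] (piece q ε θ (k + 1))).eval (knots q ε θ k)
      = knotData q ε θ k j := by
  rcases Nat.lt_or_ge K k with h | h
  · obtain rfl : k = K + 1 := by omega
    rw [piece, if_neg h.not_ge]
    interval_cases j
    · simp [knotData, data]
    · simp [knotData, data, derivData_self hq hε hθ]
    · simp [knotData, data, derivData_self hq hε hθ]
  · rw [piece_succ_eval h, sub_self, hermite_eval_zero hj]

theorem piece_eval_right (hε : 0 < ε) (hθ : θ ∈ ranges q K η) {k : ℕ} (hk : k < K + 2)
    {j : ℕ} (hj : j ≤ 2) :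
    (Polynomial.derivative^[j] (piece q ε θ k)).eval (knots q ε θ k) = knotData q ε θ k j := by
  cases k with
  | zero => interval_cases j <;> simp [piece, knotData]
  | succ k =>
    rw [piece_succ_eval (by omega), hermite_eval_self
      (sub_pos.2 (knots_lt hε hθ (by omega))).ne' hj]

theorem piece_eval_knots (hq : q = 1 ∨ q = 2) (hε : 0 < ε) (hθ : θ ∈ ranges q K η) {j : ℕ}
    (hj : j ≤ 2) (i : ℕ) (hi : i < K + 2) :
    (Polynomial.derivative^[j] (piece q ε θ i)).eval (knots q ε θ i)
      = (Polynomial.derivative^[j] (piece q ε θ (i + 1))).eval (knots q ε θ i) := by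
  rw [piece_eval_right hε hθ hi hj, piece_eval_left hε hq hθ (by omega) hj]

theorem knots_le (hε : 0 < ε) (hθ : θ ∈ ranges q K η) (i : ℕ) (hi : i < K + 1) :
    knots q ε θ i ≤ knots q ε θ (i + 1) := (knots_lt hε hθ (by omega)).le

theorem hasDerivAt_splineDeriv (hq : q = 1 ∨ q = 2) (hε : 0 < ε) (hθ : θ ∈ ranges q K η) {j : ℕ}
    (hj : j < 2) (t : ℝ) : HasDerivAt (splineDeriv q ε θ j) (splineDeriv q ε θ (j + 1) t) t := by
  refine hasDerivAt_glue (fun i hi => knots_le hε hθ i (by omega))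
    (piece_eval_knots hq hε hθ (by omega)) (piece_eval_knots hq hε hθ (by omega)) ?_ t
  intro i t
  simp only [Function.iterate_succ_apply']
  exact Polynomial.hasDerivAt _ _

/-- The piece bounds reach order 3, one more than the order j ≤ 2 of the derivative being estimated.
-/
theorem splineDeriv_lipschitz (hq : q = 1 ∨ q = 2) (hε : 0 < ε) (hε' : ε ≤ 1 / 4)
    (hη : η ∈ Ioo 0 1) (hK : K = kEps q ε) (hθ : θ ∈ ranges q K η) {j : ℕ} (hj : j ≤ 2)
    (s t : ℝ) : |splineDeriv q ε θ j s - splineDeriv q ε θ j t| ≤ 10000 * |s - t| := by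
  refine glue_lipschitz (knots_le hε hθ) (piece_eval_knots hq hε hθ hj) ?_ ?_ ?_ s t
  · intro s _ t _
    interval_cases j <;> simp [piece]
  · intro i hi s hs t ht
    refine abs_sub_le_of_derivative_le (convex_Icc _ _) ?_ hs ht
    intro u hu
    rw [← Function.iterate_succ_apply' (f := Polynomial.derivative)]
    exact abs_piece_eval_le hq hε hε' hη hK hθ (by omega) (by omega) hu
  · intro s _ t _
    interval_cases j <;> simp [piece]

theorem abs_splineDeriv_le (hq : q = 1 ∨ q = 2) (hε : 0 < ε) (hε' : ε ≤ 1 / 4)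
    (hη : η ∈ Ioo 0 1) (hK : K = kEps q ε) (hθ : θ ∈ ranges q K η) {j : ℕ} (hj : j ≤ 2)
    (t : ℝ) : |splineDeriv q ε θ j t| ≤ 10000 := by
  have hv := fun {k} (hk : k ≤ K) => abs_valData_le hq hε hε' hη hK hθ hk
  refine glue_induction (p := fun _ y => |y| ≤ 10000) ?_ ?_ ?_ t
  · intro t _
    interval_cases j <;> simp [piece]
    linarith [hv (Nat.zero_le K)]
  · intro i hi t ht
    exact abs_piece_eval_le hq hε hε' hη hK hθ (by omega) (by omega) ht
  · intro t _
    interval_cases j <;> simp [piece]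
    linarith [hv (le_refl K)]

theorem iteratedDeriv_spline (hq : q = 1 ∨ q = 2) (hε : 0 < ε) (hθ : θ ∈ ranges q K η) {j : ℕ}
    (hj : j ≤ 2) : iteratedDeriv j (spline q ε θ) = splineDeriv q ε θ j := by
  induction j with
  | zero => rfl
  | succ j ih =>
    rw [iteratedDeriv_succ, ih (by omega)]
    exact funext fun t => (hasDerivAt_splineDeriv hq hε hθ (by omega) t).deriv

theorem contDiff_spline (hq : q = 1 ∨ q = 2) (hε : 0 < ε) (hε' : ε ≤ 1 / 4)
    (hη : η ∈ Ioo 0 1) (hK : K = kEps q ε) (hθ : θ ∈ ranges q K η) :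
    ContDiff ℝ 2 (spline q ε θ) := by
  have hl : ∀ j ≤ 2, Continuous (splineDeriv q ε θ j) := fun j hj =>
    (LipschitzWith.of_dist_le_mul (K := 10000) fun s t => by
      simpa [Real.dist_eq] using splineDeriv_lipschitz hq hε hε' hη hK hθ hj s t).continuous
  refine contDiff_nat_iff_iteratedDeriv.2 ⟨fun j hj => ?_, fun j hj => ?_⟩
  · rw [iteratedDeriv_spline hq hε hθ hj]
    exact hl j hj
  · rw [iteratedDeriv_spline hq hε hθ hj.le]
    exact fun t => (hasDerivAt_splineDeriv hq hε hθ hj t).differentiableAt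

theorem isSmooth_spline (hq : q = 1 ∨ q = 2) (hε : 0 < ε) (hε' : ε ≤ 1 / 4)
    (hη : η ∈ Ioo 0 1) (hK : K = kEps q ε) (hθ : θ ∈ ranges q K η) :
    IsSmooth 10000 (spline q ε θ) := by
  refine ⟨contDiff_spline hq hε hε' hη hK hθ, fun s t => ?_⟩
  rw [iteratedDeriv_spline hq hε hθ le_rfl]
  exact splineDeriv_lipschitz hq hε hε' hη hK hθ le_rfl s t

theorem isPiecewiseQuintic_spline : IsPiecewiseQuintic (spline q ε θ) := by
  refine ⟨(Finset.range (K + 2)).image (knots q ε θ), fun t ht => ?_⟩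
  obtain ⟨i, _, hi⟩ := glue_eventuallyEq (x := knots q ε θ) (n := K + 2)
    (Q := fun n t => (piece q ε θ n).eval t) (t := t) fun i hi h =>
      ht (Finset.mem_image.2 ⟨i, Finset.mem_range.2 hi, h.symm⟩)
  exact ⟨_, natDegree_piece_le i, hi⟩

/-- Index shift: x_k is knot k + 1, because of the extra knot -1, and the piece to the right of a
knot carries the next index. -/
theorem spline_eq_piece (hq : q = 1 ∨ q = 2) (hε : 0 < ε) (hθ : θ ∈ ranges q K η) {k : ℕ}
    (hk : k < K) {t : ℝ} (ht : t ∈ Icc (iterate q ε θ k) (iterate q ε θ (k + 1))) :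
    spline q ε θ t = (piece q ε θ (k + 2)).eval t :=
  glue_eq_of_mem (x := knots q ε θ) (i := k + 1) (fun i hi => knots_le hε hθ i (by omega))
    (piece_eval_knots hq hε hθ (by omega)) (by omega) ht

theorem splineDeriv_iterate (hq : q = 1 ∨ q = 2) (hε : 0 < ε) (hθ : θ ∈ ranges q K η) {k : ℕ}
    (hk : k ≤ K) {j : ℕ} (hj : j ≤ 2) :
    splineDeriv q ε θ j (iterate q ε θ k) = data q ε θ j k := by
  rcases hk.lt_or_eq with h | rfl
  · rw [splineDeriv, glue_eq_of_mem (x := knots q ε θ) (i := k + 1) (t := iterate q ε θ k)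
      (fun i hi => knots_le hε hθ i (by omega)) (piece_eval_knots hq hε hθ hj) (by omega)
      ⟨le_rfl, knots_le hε hθ (k + 1) (by omega)⟩]
    exact piece_eval_left hε hq hθ (k := k + 1) (by omega) hj
  · rw [splineDeriv, glue_eq_of_ge (x := knots q ε θ) (t := iterate q ε θ k)
      (fun i hi => knots_le hε hθ i (by omega)) (piece_eval_knots hq hε hθ hj) le_rfl]
    exact piece_eval_left hε hq hθ (k := k + 1) (by omega) hj

theorem iteratedDeriv_spline_iterate (hq : q = 1 ∨ q = 2) (hε : 0 < ε) (hθ : θ ∈ ranges q K η)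
    {k : ℕ} (hk : k ≤ K) {j : ℕ} (hj : j ≤ 2) :
    iteratedDeriv j (spline q ε θ) (iterate q ε θ k) = data q ε θ j k := by
  rw [iteratedDeriv_spline hq hε hθ hj, splineDeriv_iterate hq hε hθ hk hj]

theorem spline_of_le (hε : 0 < ε) (hθ : θ ∈ ranges q K η) {t : ℝ} (ht : t ≤ -1) :
    spline q ε θ t = valData q ε θ 0 := by
  rw [spline, splineDeriv, glue_eq_of_le (fun i hi => knots_le hε hθ i (by omega)) ht]
  simp [piece]

theorem spline_of_ge (hq : q = 1 ∨ q = 2) (hε : 0 < ε) (hθ : θ ∈ ranges q K η) {t : ℝ}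
    (ht : iterate q ε θ K ≤ t) : spline q ε θ t = valData q ε θ K := by
  rw [spline, splineDeriv, glue_eq_of_ge (x := knots q ε θ) (n := K + 1) (t := t)
      (fun i hi => knots_le hε hθ i (by omega)) (piece_eval_knots hq hε hθ (by omega)) ht]
  simp [piece]

end Spline

/-! ### The run of the algorithm -/

theorem taylor_one (f : ℝ → ℝ) (x d : ℝ) : taylor f 1 x d = f x + iteratedDeriv 1 f x * d := by
  simp [taylor, Finset.sum_range_succ]

theorem taylor_two (f : ℝ → ℝ) (x d : ℝ) :
    taylor f 2 x d = f x + iteratedDeriv 1 f x * d + iteratedDeriv 2 f x / 2 * d ^ 2 := by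
  simp [taylor, Finset.sum_range_succ]

theorem continuous_taylor (f : ℝ → ℝ) (j : ℕ) (x : ℝ) : Continuous (taylor f j x) := by
  unfold taylor
  fun_prop

theorem sub_taylor_le_phi (f : ℝ → ℝ) (j : ℕ) (x : ℝ) {d : ℝ} (hd : d ∈ Icc (-1 : ℝ) 1) :
    f x - taylor f j x d ≤ phi f j x :=
  sub_le_sub_left (csInf_le (isCompact_Icc.image (continuous_taylor f j x)).bddBelow
    (mem_image_of_mem _ hd)) _

theorem phi_eq_zero {f : ℝ → ℝ} {j : ℕ} {x : ℝ}
    (h : ∀ i, 1 ≤ i → i ≤ j → iteratedDeriv i f x = 0) : phi f j x = 0 := by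
  have ht : ∀ d, taylor f j x d = f x := by
    intro d
    rw [taylor, Finset.sum_eq_single 0]
    · simp
    · intro i hi hi0
      rw [h i (by omega) (by simpa [Nat.lt_succ_iff] using hi)]
      simp
    · simp
  have : taylor f j x '' Icc (-1) 1 = {f x} := by
    rw [funext ht]
    exact Nonempty.image_const ⟨0, by norm_num⟩ _
  rw [phi, this, csInf_singleton, sub_self]

/-- The cubic `-a s² d + (a - 1) s d² / 2 + |d|³ / 3` is minimal at `d = s`. -/
theorem cubic_model_le {a s d : ℝ} (ha : 0 ≤ a) (hs : 0 ≤ s) :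
    -a * s ^ 2 * s + (a - 1) * s / 2 * s ^ 2 + 2 / 6 * |s| ^ 3
      ≤ -a * s ^ 2 * d + (a - 1) * s / 2 * d ^ 2 + 2 / 6 * |d| ^ 3 := by
  have key : ∀ t, 0 ≤ t → -a * s ^ 2 * s + (a - 1) * s / 2 * s ^ 2 + 2 / 6 * s ^ 3
      ≤ -a * s ^ 2 * t + (a - 1) * s / 2 * t ^ 2 + 2 / 6 * t ^ 3 := by
    intro t ht
    -- The stationary point s is a double root of the difference, and the remaining linear factor is
    -- nonnegative for t ≥ 0.
    have h : -a * s ^ 2 * t + (a - 1) * s / 2 * t ^ 2 + 2 / 6 * t ^ 3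
        - (-a * s ^ 2 * s + (a - 1) * s / 2 * s ^ 2 + 2 / 6 * s ^ 3)
        = (t - s) ^ 2 * (a * s / 2 + s / 6 + t / 3) := by ring
    have : 0 ≤ (t - s) ^ 2 * (a * s / 2 + s / 6 + t / 3) := by positivity
    linarith
  -- Replacing d by |d| changes only the linear term, whose coefficient is nonpositive.
  have h1 := key |d| (abs_nonneg d)
  rw [sq_abs] at h1
  rw [abs_of_nonneg hs]
  have h2 : a * s ^ 2 * d ≤ a * s ^ 2 * |d| :=
    mul_le_mul_of_nonneg_left (le_abs_self d) (by positivity)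
  linarith

section Run

variable {q : ℕ} {ε : ℝ} {c : Constants} {K : ℕ} {θ : Param K} {f : ℝ → ℝ}

theorem eta1_mem (c : Constants) : c.eta1 ∈ Ioo (0 : ℝ) 1 :=
  ⟨c.eta1_pos, c.eta1_le.trans_lt c.eta2_lt⟩

/-- The ratio equals 1 - 2β₀/(a + 1), and |β₀| ≤ (1 - η₁)/4 with a ≥ 0 keeps it above η₁. -/
theorem eta1_le_rho (hq : q = 1 ∨ q = 2) (hε : 0 < ε) (hθ : θ ∈ ranges q K c.eta1)
    (hf : ∀ k ≤ K, ∀ j ≤ 2, iteratedDeriv j f (iterate q ε θ k) = data q ε θ j k)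
    {k : ℕ} (hk : k < K) : c.eta1 ≤ rho f (iterate q ε θ k) (step q ε θ k) := by
  have h0 : ∀ k ≤ K, f (iterate q ε θ k) = valData q ε θ k := fun k hk => by
    simpa [data] using hf k hk 0 (by omega)
  have h1 : iteratedDeriv 1 f (iterate q ε θ k) = derivData q ε θ 1 k := by
    simpa [data] using hf k hk.le 1 (by omega)
  have h2 : iteratedDeriv 2 f (iterate q ε θ k) = derivData q ε θ 2 k := by
    simpa [data] using hf k hk.le 2 (by omega)
  have hs := step_pos (q := q) hε hθ hk
  have ha := slope_mem hθ k
  have hb := abs_le.1 (abs_beta0_le (eta1_mem c) hθ (k + 1))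
  have hη := eta1_mem c
  rw [rho, taylor_two, taylor_two, h1, h2, ← iterate_succ, h0 _ hk.le, h0 _ hk,
    valData_succ hq hε hθ, derivData_one hq hε hθ, derivData_two hq hε hθ]
  have e1 : valData q ε θ k + -slope q θ k * step q ε θ k ^ 2 * 0
      + (slope q θ k - 1) * step q ε θ k / 2 * 0 ^ 2
      - (valData q ε θ k + -slope q θ k * step q ε θ k ^ 2 * step q ε θ k
        + (slope q θ k - 1) * step q ε θ k / 2 * step q ε θ k ^ 2)
      = (slope q θ k + 1) / 2 * step q ε θ k ^ 3 := by ring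
  rw [e1, le_div_iff₀ (mul_pos (by linarith [ha.1]) (pow_pos hs 3))]
  have e2 : c.eta1 * ((slope q θ k + 1) / 2)
      ≤ (slope q θ k + 1) / 2 - beta0 θ (k + 1) := by
    nlinarith [ha.1, ha.2, hb.1, hb.2, hη.1, hη.2]
  have e3 := mul_le_mul_of_nonneg_right e2 (pow_pos hs 3).le
  linarith

theorem isMinOn_model (hq : q = 1 ∨ q = 2) (hε : 0 < ε) (hθ : θ ∈ ranges q K c.eta1)
    (hf : ∀ k ≤ K, ∀ j ≤ 2, iteratedDeriv j f (iterate q ε θ k) = data q ε θ j k)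
    {k : ℕ} (hk : k < K) : IsMinOn (model f (iterate q ε θ k) 2) univ (step q ε θ k) := by
  have h1 : iteratedDeriv 1 f (iterate q ε θ k) = derivData q ε θ 1 k := by
    simpa [data] using hf k hk.le 1 (by omega)
  have h2 : iteratedDeriv 2 f (iterate q ε θ k) = derivData q ε θ 2 k := by
    simpa [data] using hf k hk.le 2 (by omega)
  intro d _
  have := cubic_model_le (d := d) (slope_mem hθ k).1 (step_nonneg (q := q) hε hθ k)
  simp only [mem_ofPred_eq, model, taylor_two, h1, h2, derivData_one hq hε hθ,
    derivData_two hq hε hθ]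
  linarith

/-- The test of order q fails already for the trial displacement d = 1: the q-th derivative is -(1 +
β)αε with α(1 + β) ≥ 1, and for q = 2 the gradient term only adds to the decrease. -/
theorem not_terminates (hq : q = 1 ∨ q = 2) (hε : 0 < ε) (hθ : θ ∈ ranges q K c.eta1)
    (hf : ∀ k ≤ K, ∀ j ≤ 2, iteratedDeriv j f (iterate q ε θ k) = data q ε θ j k)
    {k : ℕ} (hk : k < K) : ¬ Terminates q (fun _ => ε) f (iterate q ε θ k) := by
  have h1 : iteratedDeriv 1 f (iterate q ε θ k) = derivData q ε θ 1 k := by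
    simpa [data] using hf k hk.le 1 (by omega)
  have h2 : iteratedDeriv 2 f (iterate q ε θ k) = derivData q ε θ 2 k := by
    simpa [data] using hf k hk.le 2 (by omega)
  have hs := sub_taylor_le_phi f q (iterate q ε θ k) (d := 1) (by norm_num)
  have hα := mul_le_mul_of_nonneg_right (one_le_alpha_mul hθ hk) hε.le
  have hβ := betaQ_mem hθ k
  intro h
  refine h q (by rcases hq with rfl | rfl <;> simp) (le_trans ?_ hs)
  rcases hq with rfl | rfl
  · rw [taylor_one, h1]
    simp [derivData]
    nlinarith
  · rw [taylor_two, h1, h2, derivData_one (.inr rfl) hε hθ]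
    have := mul_nonneg (slope_mem hθ k).1 (sq_nonneg (step 2 ε θ k))
    simp [derivData]
    nlinarith

/-- All iterations succeed, and σ = 2 is an endpoint of the allowed interval whether or not the
iteration is very successful. -/
theorem isRun (hq : q = 1 ∨ q = 2) (hε : 0 < ε) (hc : c.sigma0 = 2)
    (hθ : θ ∈ ranges q K c.eta1)
    (hf : ∀ k ≤ K, ∀ j ≤ 2, iteratedDeriv j f (iterate q ε θ k) = data q ε θ j k) :
    IsRun c q (fun _ => ε) f 0 K (iterate q ε θ) (step q ε θ) (fun _ => 2) where
  init_x := by simp [iterate]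
  init_sigma := hc.symm
  not_terminated k hk := not_terminates hq hε hθ hf hk
  step k hk := isMinOn_model hq hε hθ hf hk
  accept k _ _ := iterate_succ k
  reject k hk h := absurd h (eta1_le_rho hq hε hθ hf hk).not_gt
  sigma_very_successful k _ _ :=
    ⟨max_le (hc ▸ c.sigmaMin_le) (by linarith [c.gamma1_lt]), le_rfl⟩
  sigma_successful k _ _ _ := ⟨le_rfl, by linarith [c.gamma2_gt]⟩
  sigma_unsuccessful k hk h := absurd h (eta1_le_rho hq hε hθ hf hk).not_gt
  terminated := by
    have hq2 : q ≤ 2 := by omega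
    intro j hj
    rw [Finset.mem_Icc] at hj
    rw [phi_eq_zero, not_le]
    · have : (0 : ℝ) < j := by exact_mod_cast hj.1
      positivity
    · intro i hi hij
      rw [hf K le_rfl i (by omega), data, if_neg (by omega),
        derivData_self hq hε hθ (by omega)]

theorem gradEvals_eq (h : ∀ k < K, c.eta1 ≤ rho f (iterate q ε θ k) (step q ε θ k)) :
    gradEvals c f K (iterate q ε θ) (step q ε θ) = K + 1 := by
  rw [gradEvals, Finset.filter_true_of_mem fun k hk => h k (Finset.mem_range.1 hk),
    Finset.card_range, add_comm]

theorem hessEvals_eq (h : ∀ k < K, c.eta1 ≤ rho f (iterate q ε θ k) (step q ε θ k)) :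
    hessEvals c q f K (iterate q ε θ) (step q ε θ) = K + if q = 2 then 1 else 0 := by
  rw [hessEvals, Finset.filter_true_of_mem fun k hk => ?_, Finset.card_range]
  rcases Nat.eq_zero_or_pos k with h0 | h0
  · exact .inl h0
  · exact .inr (h _ (by have := Finset.mem_range.1 hk; omega))

end Run

/-! ### The spline determines the parameters -/

section Unique

variable {q K : ℕ} {ε η : ℝ} {θ θ' : Param K}

theorem param_ext (h0 : ∀ k < K, beta0 θ (k + 1) = beta0 θ' (k + 1))
    (hα : ∀ k < K, alpha θ k = alpha θ' k) (hβ : ∀ k < K, betaQ θ k = betaQ θ' k) : θ = θ' := by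
  refine Prod.ext (funext fun k => ?_) (Prod.ext (funext fun k => ?_) (funext fun k => ?_))
  · simpa [beta0] using h0 k k.2
  · simpa [alpha] using hα k k.2
  · simpa [betaQ] using hβ k k.2

theorem betaQ_eq_of_slope_eq {k l : ℕ} (h : slope q θ k = slope q θ' l) :
    betaQ θ k = betaQ θ' l := by
  unfold slope at h
  split_ifs at h <;> linarith

/-- Eliminating the second slope from the two equations leaves (s - s')(a s + s') = 0, whose second
factor is positive. -/
theorem step_eq_and_slope_eq (hq : q = 1 ∨ q = 2) (hε : 0 < ε) (hθ : θ ∈ ranges q K η)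
    (hθ' : θ' ∈ ranges q K η) {k : ℕ} (hk : k < K)
    (h1 : derivData q ε θ 1 k = derivData q ε θ' 1 k)
    (h2 : derivData q ε θ 2 k = derivData q ε θ' 2 k) :
    step q ε θ k = step q ε θ' k ∧ slope q θ k = slope q θ' k := by
  rw [derivData_one hq hε hθ, derivData_one hq hε hθ'] at h1
  rw [derivData_two hq hε hθ, derivData_two hq hε hθ'] at h2
  have hs := step_pos (q := q) hε hθ hk
  have hs' := step_pos (q := q) hε hθ' hk
  have ha := mul_nonneg (slope_mem hθ k).1 hs.le
  have e : step q ε θ k = step q ε θ' k := by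
    have : (step q ε θ k - step q ε θ' k) * (slope q θ k * step q ε θ k + step q ε θ' k) = 0 := by
      linear_combination -h1 - step q ε θ' k * h2
    rcases mul_eq_zero.1 this with h | h
    · exact sub_eq_zero.1 h
    · linarith
  refine ⟨e, ?_⟩
  rw [e] at h2
  linarith [mul_right_cancel₀ hs'.ne' h2]

/-- Agreement is assumed only near the iterates of θ. By induction both sequences of iterates
coincide: equal derivatives at a common iterate force equal steps. -/
theorem eq_of_eventuallyEq_spline (hq : q = 1 ∨ q = 2) (hε : 0 < ε) (hθ : θ ∈ ranges q K η)
    (hθ' : θ' ∈ ranges q K η)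
    (h : ∀ k ≤ K, spline q ε θ =ᶠ[𝓝 (iterate q ε θ k)] spline q ε θ') : θ = θ' := by
  have hd : ∀ k ≤ K, iterate q ε θ k = iterate q ε θ' k → ∀ j ≤ 2,
      data q ε θ j k = data q ε θ' j k := by
    intro k hk hx j hj
    rw [← iteratedDeriv_spline_iterate hq hε hθ hk hj,
      ← iteratedDeriv_spline_iterate hq hε hθ' hk hj, ← hx]
    exact (h k hk).iteratedDeriv_eq j
  have hx : ∀ k ≤ K, iterate q ε θ k = iterate q ε θ' k := by
    intro k
    induction k with
    | zero => simp [iterate]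
    | succ k ih =>
      intro hk
      have hd := hd k (by omega) (ih (by omega))
      rw [iterate_succ, iterate_succ, ih (by omega), (step_eq_and_slope_eq hq hε hθ hθ' hk
        (by simpa [data] using hd 1 (by omega)) (by simpa [data] using hd 2 (by omega))).1]
  have hs : ∀ k < K, step q ε θ k = step q ε θ' k ∧ slope q θ k = slope q θ' k := by
    intro k hk
    have hd := hd k hk.le (hx k hk.le)
    exact step_eq_and_slope_eq hq hε hθ hθ' hk
      (by simpa [data] using hd 1 (by omega)) (by simpa [data] using hd 2 (by omega))
  have hv : ∀ k ≤ K, valData q ε θ k = valData q ε θ' k := fun k hk => by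
    simpa [data] using hd k hk (hx k hk) 0 (by omega)
  refine param_ext (fun k hk => ?_) (fun k hk => ?_) fun k hk => betaQ_eq_of_slope_eq (hs k hk).2
  · have := hv (k + 1) hk
    rw [valData_succ hq hε hθ, valData_succ hq hε hθ', hv k hk.le, (hs k hk).1, (hs k hk).2] at this
    linarith [mul_right_cancel₀ (pow_pos (step_pos (q := q) hε hθ' hk) 3).ne'
      (add_left_cancel this)]
  · have h1 := alpha_mul_eq hq hε hθ k
    rw [(hs k hk).1, ← alpha_mul_eq hq hε hθ'] at h1
    exact mul_right_cancel₀ hε.ne' h1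

end Unique

/-! ### Continuous dependence on the parameters -/

section Continuity

variable {q K : ℕ} {ε η : ℝ}

theorem continuous_alpha (k : ℕ) : Continuous fun θ : Param K => alpha θ k := by
  unfold alpha
  split_ifs <;> fun_prop

theorem continuous_betaQ (k : ℕ) : Continuous fun θ : Param K => betaQ θ k := by
  unfold betaQ
  split_ifs <;> fun_prop

theorem continuous_beta0 (k : ℕ) : Continuous fun θ : Param K => beta0 θ k := by
  cases k with
  | zero => exact continuous_const
  | succ k =>
    simp only [beta0]
    split_ifs <;> fun_prop

theorem continuous_step (hq : q = 1 ∨ q = 2) (k : ℕ) :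
    Continuous fun θ : Param K => step q ε θ k := by
  refine ((continuous_alpha k).mul continuous_const).rpow_const fun θ => .inr ?_
  rcases hq with rfl | rfl <;> norm_num

theorem continuous_iterate (hq : q = 1 ∨ q = 2) (k : ℕ) :
    Continuous fun θ : Param K => iterate q ε θ k :=
  continuous_finsetSum _ fun i _ => continuous_step hq i

theorem continuous_derivData (hq : q = 1 ∨ q = 2) (j k : ℕ) :
    Continuous fun θ : Param K => derivData q ε θ j k := by
  have hα := continuous_alpha (K := K) k
  have hβ := continuous_betaQ (K := K) k
  have hp : Continuous fun θ : Param K => (alpha θ k * ε) ^ ((q : ℝ) / (3 - (q : ℝ))) := by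
    refine (hα.mul continuous_const).rpow_const fun θ => .inr ?_
    rcases hq with rfl | rfl <;> norm_num
  unfold derivData betaP
  split_ifs <;> fun_prop

theorem continuous_valData (hq : q = 1 ∨ q = 2) (k : ℕ) :
    Continuous fun θ : Param K => valData q ε θ k := by
  induction k with
  | zero => exact continuous_const
  | succ k ih =>
    have h1 := continuous_derivData (K := K) (ε := ε) hq 1 k
    have h2 := continuous_derivData (K := K) (ε := ε) hq 2 k
    have hs := continuous_step (K := K) (ε := ε) hq k
    have hb := continuous_beta0 (K := K) (k + 1)
    unfold valData
    fun_prop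

theorem continuous_knots (hq : q = 1 ∨ q = 2) (k : ℕ) :
    Continuous fun θ : Param K => knots q ε θ k := by
  cases k with
  | zero => exact continuous_const
  | succ k => exact continuous_iterate hq k

theorem continuous_knotData (hq : q = 1 ∨ q = 2) (k j : ℕ) :
    Continuous fun θ : Param K => knotData q ε θ k j := by
  cases k with
  | zero =>
    simp only [knotData]
    split_ifs
    · exact continuous_valData hq 0
    · exact continuous_const
  | succ k =>
    simp only [knotData, data]
    split_ifs
    · exact continuous_valData hq k
    · exact continuous_derivData hq j k

theorem continuous_hermite_eval {T : Type*} [TopologicalSpace T] {h u : T → ℝ} {a b : T → ℕ → ℝ}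
    (hh : Continuous h) (hne : ∀ z, h z ≠ 0) (ha : ∀ j, Continuous fun z => a z j)
    (hb : ∀ j, Continuous fun z => b z j) (hu : Continuous u) :
    Continuous fun z => (hermite (h z) (a z) (b z)).eval (u z) := by
  have h0 := ha 0
  have h1 := ha 1
  have h2 := ha 2
  have g0 := hb 0
  have g1 := hb 1
  have g2 := hb 2
  have hi : Continuous fun z => (h z)⁻¹ := hh.inv₀ hne
  simp only [hermite, Polynomial.eval_add, Polynomial.eval_mul, Polynomial.eval_C,
    Polynomial.eval_pow, Polynomial.eval_X, div_eq_mul_inv, ← inv_pow]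
  fun_prop

theorem continuous_piece_eval (hq : q = 1 ∨ q = 2) (hε : 0 < ε) (n : ℕ) :
    Continuous fun z : ranges q K η × ℝ => (piece q ε z.1.1 n).eval z.2 := by
  have hc : Continuous fun z : ranges q K η × ℝ => z.1.1 := by fun_prop
  have hv := fun k => (continuous_valData (K := K) (ε := ε) hq k).comp hc
  have hk := fun k => (continuous_knots (K := K) (ε := ε) hq k).comp hc
  have hd := fun k j => (continuous_knotData (K := K) (ε := ε) hq k j).comp hc
  cases n with
  | zero =>
    simp only [piece, Polynomial.eval_C]
    exact hv 0
  | succ k =>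
    rcases Nat.lt_or_ge K k with h | h
    · simp only [piece, if_neg h.not_ge, Polynomial.eval_C]
      exact hv K
    · simp only [piece, if_pos h, Polynomial.eval_comp, Polynomial.eval_sub, Polynomial.eval_X,
        Polynomial.eval_C]
      exact continuous_hermite_eval ((hk (k + 1)).sub (hk k))
        (fun z => (sub_pos.2 (knots_lt hε z.1.2 h)).ne') (hd k) (hd (k + 1))
        (continuous_snd.sub (hk k))

theorem continuous_spline (hq : q = 1 ∨ q = 2) (hε : 0 < ε) :
    Continuous fun z : ranges q K η × ℝ => spline q ε z.1.1 z.2 :=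
  continuous_glue (x := fun θ : ranges q K η => knots q ε θ.1)
    (Q := fun θ n t => (piece q ε θ.1 n).eval t)
    (fun i _ => (continuous_knots hq i).comp continuous_subtype_val)
    (fun θ i hi => knots_le hε θ.2 i (by omega))
    (fun i _ => continuous_piece_eval hq hε i)
    (fun θ i hi => piece_eval_knots hq hε θ.2 (Nat.zero_le 2) i hi)

/-- Functions that factor through the projection onto a compact interval are determined there, and
on a compact space joint continuity curries to continuity for the uniform distance. -/
theorem exists_continuous_boundedContinuousFunction {T : Type*} [TopologicalSpace T]
    {g : T → ℝ → ℝ} (hg : Continuous fun z : T × ℝ => g z.1 z.2) {a b : ℝ} (hab : a ≤ b)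
    (hproj : ∀ θ t, g θ (projIcc a b hab t) = g θ t) :
    ∃ φ : T → (ℝ →ᵇ ℝ), Continuous φ ∧ ∀ θ, (φ θ : ℝ → ℝ) = g θ := by
  let G : C(T × Icc a b, ℝ) := ⟨fun z => g z.1 z.2.1, hg.comp
    (continuous_fst.prodMk (continuous_subtype_val.comp continuous_snd))⟩
  let π : C(ℝ, Icc a b) := ⟨projIcc a b hab, continuous_projIcc⟩
  refine ⟨fun θ => (BoundedContinuousFunction.mkOfCompact (G.curry θ)).compContinuous π, ?_, ?_⟩
  · exact (BoundedContinuousFunction.continuous_compContinuous π).comp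
      ((ContinuousMap.isometryEquivBoundedOfCompact _ _).continuous.comp G.curry.continuous)
  · exact fun θ => funext fun t => hproj θ t

theorem exists_continuous_spline (hq : q = 1 ∨ q = 2) (hε : 0 < ε) (hε' : ε ≤ 1 / 4) :
    ∃ φ : ranges q K η → (ℝ →ᵇ ℝ), Continuous φ ∧ ∀ θ, (φ θ : ℝ → ℝ) = spline q ε θ.1 := by
  -- Steps are at most one, so [-1, K] contains every knot up to x_K for all parameters at once.
  have hle : (-1 : ℝ) ≤ K := by linarith [Nat.cast_nonneg (α := ℝ) K]
  refine exists_continuous_boundedContinuousFunction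
    (g := fun θ : ranges q K η => spline q ε θ.1) (continuous_spline hq hε) hle fun θ t => ?_
  rcases le_total t (-1) with h | h
  · rw [projIcc_of_le_left hle h, spline_of_le hε θ.2 h, spline_of_le hε θ.2 le_rfl]
  rcases le_total t K with h' | h'
  · rw [projIcc_of_mem hle ⟨h, h'⟩]
  · have := iterate_le hq hε hε' θ.2 K
    rw [projIcc_of_right_le hle h', spline_of_ge hq hε θ.2 this,
      spline_of_ge hq hε θ.2 (this.trans h')]

theorem isCompact_ranges : IsCompact (ranges q K η) := by
  refine Metric.isCompact_of_isClosed_isBounded ?_ ?_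
  · have : ranges q K η = ⋂ k : Fin K, {θ | |θ.1 k| ≤ (1 - η) / 4} ∩
        {θ | θ.2.1 k ∈ Icc (1 : ℝ) 2} ∩
        {θ | θ.2.2 k ∈ (if q = 1 then Icc (0 : ℝ) (1 / 2) else Icc (-(1 / 2) : ℝ) 0)} ∩
        {θ | 1 ≤ θ.2.1 k * (1 + θ.2.2 k)} := by
      ext θ
      simp [ranges, and_assoc]
    rw [this]
    refine isClosed_iInter fun k => ((IsClosed.inter ?_ ?_).inter ?_).inter ?_
    · exact isClosed_le (by fun_prop) (by fun_prop)
    · exact isClosed_Icc.preimage (by fun_prop : Continuous fun θ : Param K => θ.2.1 k)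
    · refine IsClosed.preimage (by fun_prop : Continuous fun θ : Param K => θ.2.2 k) ?_
      split_ifs <;> exact isClosed_Icc
    · exact isClosed_le (by fun_prop) (by fun_prop)
  · refine ((Metric.isBounded_closedBall (x := (0 : Fin K → ℝ)) (r := |(1 - η) / 4|)).prod
      ((Metric.isBounded_closedBall (x := (0 : Fin K → ℝ)) (r := 2)).prod
      (Metric.isBounded_closedBall (x := (0 : Fin K → ℝ)) (r := 2)))).subset ?_
    intro θ hθ
    simp only [mem_prod, mem_closedBall_zero_iff]
    refine ⟨(pi_norm_le_iff_of_nonneg (abs_nonneg _)).2 fun k => ?_,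
      (pi_norm_le_iff_of_nonneg (by norm_num)).2 fun k => ?_,
      (pi_norm_le_iff_of_nonneg (by norm_num)).2 fun k => ?_⟩
    · exact (hθ k).1.trans (le_abs_self _)
    · have := (hθ k).2.1
      rw [Real.norm_eq_abs, abs_le]
      constructor <;> linarith [this.1, this.2]
    · have := (hθ k).2.2.1
      rw [Real.norm_eq_abs, abs_le]
      split_ifs at this <;> constructor <;> linarith [this.1, this.2]

end Continuity

/-! ### Recovering the parameters in a Lipschitz manner -/

/-- `g` is Lipschitz continuous on `U` with respect to the gauge `D`. -/
def ControlledOn {T : Type*} (U : Set T) (D : T → T → ℝ) (g : T → ℝ) : Prop :=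
  ∃ C, 0 ≤ C ∧ ∀ θ ∈ U, ∀ θ' ∈ U, |g θ - g θ'| ≤ C * D θ θ'

namespace ControlledOn

variable {T : Type*} {U : Set T} {D : T → T → ℝ} {g g' : T → ℝ}

theorem const (a : ℝ) : ControlledOn U D fun _ => a := ⟨0, le_rfl, by simp⟩

theorem congr (h : ControlledOn U D g) (hg : ∀ θ ∈ U, g' θ = g θ) : ControlledOn U D g' := by
  obtain ⟨C, hC, h⟩ := h
  exact ⟨C, hC, fun θ hθ θ' hθ' => by rw [hg θ hθ, hg θ' hθ']; exact h θ hθ θ' hθ'⟩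

theorem add (h : ControlledOn U D g) (h' : ControlledOn U D g') :
    ControlledOn U D fun θ => g θ + g' θ := by
  obtain ⟨C, hC, h⟩ := h
  obtain ⟨C', hC', h'⟩ := h'
  refine ⟨C + C', add_nonneg hC hC', fun θ hθ θ' hθ' => ?_⟩
  have e : g θ + g' θ - (g θ' + g' θ') = (g θ - g θ') + (g' θ - g' θ') := by ring
  rw [e, add_mul]
  exact (abs_add_le _ _).trans (add_le_add (h θ hθ θ' hθ') (h' θ hθ θ' hθ'))

theorem neg (h : ControlledOn U D g) : ControlledOn U D fun θ => -g θ := by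
  obtain ⟨C, hC, h⟩ := h
  refine ⟨C, hC, fun θ hθ θ' hθ' => ?_⟩
  rw [neg_sub_neg, abs_sub_comm]
  exact h θ hθ θ' hθ'

theorem sub (h : ControlledOn U D g) (h' : ControlledOn U D g') :
    ControlledOn U D fun θ => g θ - g' θ := by
  simpa only [sub_eq_add_neg] using h.add h'.neg

theorem mul (h : ControlledOn U D g) (h' : ControlledOn U D g') {B B' : ℝ}
    (hB : ∀ θ ∈ U, |g θ| ≤ B) (hB' : ∀ θ ∈ U, |g' θ| ≤ B') :
    ControlledOn U D fun θ => g θ * g' θ := by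
  obtain ⟨C, hC, h⟩ := h
  obtain ⟨C', hC', h'⟩ := h'
  refine ⟨|B| * C' + C * |B'|, by positivity, fun θ hθ θ' hθ' => ?_⟩
  have e : g θ * g' θ - g θ' * g' θ' = g θ * (g' θ - g' θ') + (g θ - g θ') * g' θ' := by ring
  rw [e]
  refine (abs_add_le _ _).trans ?_
  rw [abs_mul, abs_mul]
  have h1 := mul_le_mul ((hB θ hθ).trans (le_abs_self B)) (h' θ hθ θ' hθ') (abs_nonneg _)
    (abs_nonneg B)
  have h2 := mul_le_mul (h θ hθ θ' hθ') ((hB' θ' hθ').trans (le_abs_self B')) (abs_nonneg _)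
    ((abs_nonneg _).trans (h θ hθ θ' hθ'))
  linarith

theorem inv (h : ControlledOn U D g) {c : ℝ} (hc : 0 < c) (hg : ∀ θ ∈ U, c ≤ g θ) :
    ControlledOn U D fun θ => (g θ)⁻¹ := by
  obtain ⟨C, hC, h⟩ := h
  refine ⟨C / (c * c), by positivity, fun θ hθ θ' hθ' => ?_⟩
  have h1 := hc.trans_le (hg θ hθ)
  have h2 := hc.trans_le (hg θ' hθ')
  have e : (g θ)⁻¹ - (g θ')⁻¹ = (g θ' - g θ) / (g θ * g θ') := by field_simp
  rw [e, abs_div, abs_sub_comm, abs_of_pos (mul_pos h1 h2), div_mul_eq_mul_div]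
  exact div_le_div₀ ((abs_nonneg _).trans (h θ hθ θ' hθ')) (h θ hθ θ' hθ') (by positivity)
    (mul_le_mul (hg θ hθ) (hg θ' hθ') hc.le h1.le)

end ControlledOn

/-! ### Quintic polynomials and their values at six nodes. -/

open Polynomial in
/-- A polynomial of degree at most five and its first derivatives are bounded by the values at any
six nodes. -/
theorem exists_abs_derivative_eval_le (s : Finset ℝ) (hs : s.card = 6) (X : ℝ) :
    ∃ C, 0 ≤ C ∧ ∀ R : ℝ[X], R.natDegree ≤ 5 → ∀ m, (∀ y ∈ s, |R.eval y| ≤ m) →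
      ∀ j ≤ 3, ∀ t ∈ Icc 0 X, |(derivative^[j] R).eval t| ≤ C * m := by
  have hB : ∀ (j : ℕ) (y : ℝ), ∃ B, ∀ t ∈ Icc 0 X,
      ‖(derivative^[j] (Lagrange.basis s id y)).eval t‖ ≤ B := fun j y =>
    isCompact_Icc.exists_bound_of_continuousOn (Polynomial.continuous _).continuousOn
  choose B hB using hB
  -- Bounds for derivatives of the Lagrange basis, summed over j to give one constant for all orders
  -- up to 3.
  refine ⟨∑ j ∈ Finset.range 4, ∑ y ∈ s, |B j y|, by positivity, ?_⟩
  intro R hR m hm j hj t ht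
  have hm0 : 0 ≤ m := by
    obtain ⟨y, hy⟩ := Finset.card_pos.1 (by omega : 0 < s.card)
    exact (abs_nonneg _).trans (hm y hy)
  have hdeg : R.degree < s.card := by
    rw [hs]
    exact (Polynomial.degree_le_natDegree).trans_lt (by exact_mod_cast Nat.lt_succ_of_le hR)
  have hR' : R = ∑ y ∈ s, C (R.eval y) * Lagrange.basis s id y := by
    conv_lhs => rw [Lagrange.eq_interpolate (v := id) (Function.injective_id.injOn) hdeg]
    rw [Lagrange.interpolate_apply]
    rfl
  rw [hR', Polynomial.iterate_derivative_sum, Polynomial.eval_finsetSum]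
  calc |∑ y ∈ s, (derivative^[j] (C (R.eval y) * Lagrange.basis s id y)).eval t|
      ≤ ∑ y ∈ s, |(derivative^[j] (C (R.eval y) * Lagrange.basis s id y)).eval t| :=
        Finset.abs_sum_le_sum_abs _ _
    _ ≤ ∑ y ∈ s, |B j y| * m := by
        refine Finset.sum_le_sum fun y hy => ?_
        rw [Polynomial.iterate_derivative_C_mul, Polynomial.eval_mul, Polynomial.eval_C, abs_mul,
          mul_comm]
        exact mul_le_mul ((hB j y t ht).trans (le_abs_self _)) (hm y hy) (abs_nonneg _)
          (abs_nonneg _)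
    _ = (∑ y ∈ s, |B j y|) * m := by rw [Finset.sum_mul]
    _ ≤ _ := by
        refine mul_le_mul_of_nonneg_right ?_ hm0
        exact Finset.single_le_sum (f := fun j => ∑ y ∈ s, |B j y|)
          (fun i _ => Finset.sum_nonneg fun y _ => abs_nonneg _) (Finset.mem_range.2 (by omega))

-- Both the polynomial and the evaluation point vary. The first change is controlled by the six
-- nodes, the second by the derivative of order j + 1 ≤ 3.
open Polynomial in
theorem ControlledOn.derivative_eval {T : Type*} {U : Set T} {D : T → T → ℝ} {P : T → ℝ[X]}
    (hP : ∀ θ ∈ U, (P θ).natDegree ≤ 5) {s : Finset ℝ} (hs : s.card = 6)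
    (hD : ∀ θ ∈ U, ∀ θ' ∈ U, ∀ y ∈ s, |(P θ).eval y - (P θ').eval y| ≤ D θ θ') {M : ℝ}
    (hM : ∀ θ ∈ U, ∀ y ∈ s, |(P θ).eval y| ≤ M) {g : T → ℝ} (hg : ControlledOn U D g) {X : ℝ}
    (hgX : ∀ θ ∈ U, g θ ∈ Icc 0 X) {j : ℕ} (hj : j ≤ 2) :
    ControlledOn U D fun θ => (derivative^[j] (P θ)).eval (g θ) := by
  obtain ⟨C, hC, hpoly⟩ := exists_abs_derivative_eval_le s hs X
  obtain ⟨C', hC', hg⟩ := hg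
  refine ⟨C + C * |M| * C', by positivity, fun θ hθ θ' hθ' => ?_⟩
  have h1 : |(derivative^[j] (P θ)).eval (g θ) - (derivative^[j] (P θ')).eval (g θ)|
      ≤ C * D θ θ' := by
    rw [← Polynomial.eval_sub, ← Polynomial.iterate_derivative_sub]
    refine hpoly _ ?_ _ (fun y hy => ?_) j (by omega) _ (hgX θ hθ)
    · exact (Polynomial.natDegree_sub_le _ _).trans (max_le (hP θ hθ) (hP θ' hθ'))
    · rw [Polynomial.eval_sub]
      exact hD θ hθ θ' hθ' y hy
  have h2 : |(derivative^[j] (P θ')).eval (g θ) - (derivative^[j] (P θ')).eval (g θ')|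
      ≤ C * |M| * |g θ - g θ'| := by
    refine abs_sub_le_of_derivative_le (convex_Icc 0 X) (fun t ht => ?_) (hgX θ hθ) (hgX θ' hθ')
    rw [← Function.iterate_succ_apply' (f := Polynomial.derivative)]
    exact hpoly _ (hP θ' hθ') _ (fun y hy => (hM θ' hθ' y hy).trans (le_abs_self M)) _ (by omega)
      t ht
  have h3 := mul_le_mul_of_nonneg_left (hg θ hθ θ' hθ') (by positivity : 0 ≤ C * |M|)
  calc _ ≤ _ := abs_sub_le _ ((derivative^[j] (P θ')).eval (g θ)) _
    _ ≤ C * D θ θ' + C * |M| * (C' * D θ θ') := add_le_add h1 (h2.trans h3)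
    _ = _ := by ring

section Recover

variable {q K : ℕ} {ε η : ℝ}

theorem le_step (hq : q = 1 ∨ q = 2) (hε : 0 < ε) (hε' : ε ≤ 1 / 4) {θ : Param K}
    (hθ : θ ∈ ranges q K η) {k : ℕ} (hk : k < K) : ε ≤ step q ε θ k := by
  have h1 := alpha_mul_eq hq hε hθ k
  have h2 := (alpha_mem hθ hk).1
  have h3 := step_le_one hq hε hε' hθ k
  have h4 := step_nonneg hε hθ (q := q) k
  have h5 : step q ε θ k ^ (3 - q) ≤ step q ε θ k :=
    pow_le_of_le_one h4 h3 (by omega)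
  nlinarith

/-- Quantitative form of `step_eq_and_slope_eq`: in the same identity the factor a s + s' is at
least ε. -/
theorem controlledOn_step (hq : q = 1 ∨ q = 2) (hε : 0 < ε) (hε' : ε ≤ 1 / 4)
    {U : Set (Param K)} (hU : U ⊆ ranges q K η) {D : Param K → Param K → ℝ} {k : ℕ} (hk : k < K)
    (h1 : ControlledOn U D fun θ => derivData q ε θ 1 k)
    (h2 : ControlledOn U D fun θ => derivData q ε θ 2 k) :
    ControlledOn U D fun θ => step q ε θ k := by
  obtain ⟨C₁, hC₁, h1⟩ := h1
  obtain ⟨C₂, hC₂, h2⟩ := h2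
  refine ⟨(C₁ + C₂) / ε, by positivity, fun θ hθ θ' hθ' => ?_⟩
  have e1 := h1 θ hθ θ' hθ'
  have e2 := h2 θ hθ θ' hθ'
  have hs := step_nonneg hε (hU hθ) (q := q) k
  have hs' := le_step hq hε hε' (hU hθ') hk
  have hs'1 := step_le_one hq hε hε' (hU hθ') k
  have ha := mul_nonneg (slope_mem (hU hθ) k).1 hs
  have e : (step q ε θ k - step q ε θ' k) * (slope q θ k * step q ε θ k + step q ε θ' k)
      = -(derivData q ε θ 1 k - derivData q ε θ' 1 k)
        - step q ε θ' k * (derivData q ε θ 2 k - derivData q ε θ' 2 k) := by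
    rw [derivData_one hq hε (hU hθ), derivData_one hq hε (hU hθ'), derivData_two hq hε (hU hθ),
      derivData_two hq hε (hU hθ')]
    ring
  rw [div_mul_eq_mul_div, le_div_iff₀ hε]
  calc |step q ε θ k - step q ε θ' k| * ε
      ≤ |step q ε θ k - step q ε θ' k| * (slope q θ k * step q ε θ k + step q ε θ' k) := by
        gcongr; linarith
    _ = |(step q ε θ k - step q ε θ' k) * (slope q θ k * step q ε θ k + step q ε θ' k)| := by
        rw [abs_mul, abs_of_nonneg (a := slope q θ k * _ + _) (by linarith)]
    _ ≤ |derivData q ε θ 1 k - derivData q ε θ' 1 k|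
        + step q ε θ' k * |derivData q ε θ 2 k - derivData q ε θ' 2 k| := by
        rw [e]
        refine (abs_sub _ _).trans ?_
        rw [abs_neg, abs_mul, abs_of_nonneg (hε.le.trans hs')]
    _ ≤ C₁ * D θ θ' + 1 * (C₂ * D θ θ') := by
        gcongr
    _ = (C₁ + C₂) * D θ θ' := by ring

/-- On a set of parameters for which each polynomial piece is visible at six fixed nodes, the
parameters depend in a Lipschitz manner on the uniform distance of the splines. -/
theorem controlledOn_param (hq : q = 1 ∨ q = 2) (hε : 0 < ε) (hε' : ε ≤ 1 / 4)
    (hη : η ∈ Ioo 0 1) (hK : K = kEps q ε) {U : Set (Param K)} (hU : U ⊆ ranges q K η)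
    {D : Param K → Param K → ℝ}
    (hD : ∀ θ ∈ U, ∀ θ' ∈ U, ∀ t, |spline q ε θ t - spline q ε θ' t| ≤ D θ θ')
    (hs : ∀ k < K, ∃ s : Finset ℝ, s.card = 6 ∧
      ∀ θ ∈ U, ∀ y ∈ s, y ∈ Icc (iterate q ε θ k) (iterate q ε θ (k + 1)))
    {k : ℕ} (hk : k < K) :
    ControlledOn U D (fun θ => beta0 θ (k + 1)) ∧ ControlledOn U D (fun θ => alpha θ k) ∧
      ControlledOn U D (fun θ => betaQ θ k) := by
  have hX : ∀ k ≤ K, ∀ θ ∈ U, iterate q ε θ k ∈ Icc (0 : ℝ) K := fun k hk θ hθ =>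
    ⟨iterate_nonneg hε (hU hθ) k, (iterate_le hq hε hε' (hU hθ) k).trans (by exact_mod_cast hk)⟩
  have hpoly : ∀ k < K, ∀ g : Param K → ℝ, ControlledOn U D g → (∀ θ ∈ U, g θ ∈ Icc (0 : ℝ) K) →
      ∀ j ≤ 2, ControlledOn U D
        fun θ => (Polynomial.derivative^[j] (piece q ε θ (k + 2))).eval (g θ) := by
    intro k hk g hg hgX j hj
    obtain ⟨s, hs, hmem⟩ := hs k hk
    refine ControlledOn.derivative_eval (fun θ _ => natDegree_piece_le _) hs ?_ (M := 10000) ?_ hg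
      hgX hj
    · intro θ hθ θ' hθ' y hy
      rw [← spline_eq_piece hq hε (hU hθ) hk (hmem θ hθ y hy),
        ← spline_eq_piece hq hε (hU hθ') hk (hmem θ' hθ' y hy)]
      exact hD θ hθ θ' hθ' y
    · intro θ hθ y hy
      exact abs_piece_eval_le hq hε hε' hη hK (hU hθ) (k := k + 1) (by omega) (Nat.zero_le 3)
        (hmem θ hθ y hy)
  have hdata : ∀ k < K, ControlledOn U D (fun θ => iterate q ε θ k) → ∀ j ≤ 2,
      ControlledOn U D fun θ => data q ε θ j k := fun k hk hx j hj =>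
    (hpoly k hk _ hx (hX k hk.le) j hj).congr fun θ hθ =>
      (piece_eval_left hε hq (hU hθ) (k := k + 1) (by omega) hj).symm
  have hstep : ∀ k < K, ControlledOn U D (fun θ => iterate q ε θ k) →
      ControlledOn U D fun θ => step q ε θ k := by
    intro k hk hx
    refine controlledOn_step hq hε hε' hU hk ?_ ?_
    · simpa [data] using hdata k hk hx 1 (by omega)
    · simpa [data] using hdata k hk hx 2 (by omega)
  -- Control passes along the run: from x_k to the derivatives there, to s_k, and so to x_{k+1}.
  have hit : ∀ k ≤ K, ControlledOn U D fun θ => iterate q ε θ k := by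
    intro k
    induction k with
    | zero =>
      intro _
      simpa [iterate] using ControlledOn.const 0
    | succ k ih =>
      intro hk
      simp only [iterate_succ]
      exact (ih (by omega)).add (hstep k hk (ih (by omega)))
  have hx := hit k hk.le
  have hstep := hstep k hk hx
  have hs0 : ∀ θ ∈ U, |step q ε θ k| ≤ 1 := fun θ hθ => by
    rw [abs_of_nonneg (step_nonneg hε (hU hθ) k)]
    exact step_le_one hq hε hε' (hU hθ) k
  have hsε : ∀ θ ∈ U, ε ≤ step q ε θ k := fun θ hθ => le_step hq hε hε' (hU hθ) hk
  have hinv := hstep.inv hε hsε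
  have hi0 : ∀ θ ∈ U, |(step q ε θ k)⁻¹| ≤ ε⁻¹ := fun θ hθ => by
    rw [abs_of_nonneg (inv_nonneg.2 (step_nonneg hε (hU hθ) k))]
    exact inv_anti₀ hε (hsε θ hθ)
  have hne : ∀ θ ∈ U, step q ε θ k ≠ 0 := fun θ hθ => (hε.trans_le (hsε θ hθ)).ne'
  have hslope : ControlledOn U D fun θ => slope q θ k := by
    have h2 : ControlledOn U D fun θ => derivData q ε θ 2 k := by
      simpa [data] using hdata k hk hx 2 le_rfl
    refine ((h2.mul hinv (fun θ hθ => abs_derivData_two_le hq hε hε' (hU hθ) k) hi0).add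
      (.const 1)).congr fun θ hθ => ?_
    rw [derivData_two hq hε (hU hθ), mul_inv_cancel_right₀ (hne θ hθ)]
    ring
  refine ⟨?_, ?_, ?_⟩
  · have hv : ControlledOn U D fun θ => valData q ε θ k := by
      simpa [data] using hdata k hk hx 0 (by omega)
    -- The value at x_{k+1} is read from the piece on its left, which exists even when k + 1 = K.
    have hv' : ControlledOn U D fun θ => valData q ε θ (k + 1) :=
      (hpoly k hk _ (hit (k + 1) hk) (hX (k + 1) hk) 0 (by omega)).congr fun θ hθ =>
        (piece_eval_right hε (hU hθ) (k := k + 2) (by omega) (Nat.zero_le 2)).symm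
    have hB : ∀ k ≤ K, ∀ θ ∈ U, |valData q ε θ k| ≤ 48 := fun k hk θ hθ =>
      abs_valData_le hq hε hε' hη hK (hU hθ) hk
    have hi3 : ControlledOn U D fun θ =>
        (step q ε θ k)⁻¹ * ((step q ε θ k)⁻¹ * (step q ε θ k)⁻¹) := by
      refine hinv.mul (hinv.mul hinv hi0 hi0) hi0 (B' := ε⁻¹ * ε⁻¹) fun θ hθ => ?_
      rw [abs_mul]
      exact mul_le_mul (hi0 θ hθ) (hi0 θ hθ) (abs_nonneg _) (by positivity)
    -- Solving the value recursion: β₀ = (f_{k+1} - f_k)/s³ + (a + 1)/2.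
    refine (((hv'.sub hv).mul hi3 (B := 48 + 48) (B' := ε⁻¹ * (ε⁻¹ * ε⁻¹)) ?_ ?_).add
      ((hslope.add (.const 1)).mul (.const (1 / 2)) (B := 5 / 2) (B' := 1 / 2) ?_ ?_)).congr ?_
    · exact fun θ hθ => (abs_sub _ _).trans (add_le_add (hB _ hk θ hθ) (hB _ hk.le θ hθ))
    · intro θ hθ
      rw [abs_mul, abs_mul]
      gcongr <;> exact hi0 θ hθ
    · intro θ hθ
      have := slope_mem (hU hθ) k
      rw [abs_le]
      constructor <;> linarith [this.1, this.2]
    · intro θ _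
      norm_num
    · intro θ hθ
      have := hne θ hθ
      rw [valData_succ hq hε (hU hθ)]
      field_simp
      ring
  · have hα : ∀ θ ∈ U, alpha θ k = step q ε θ k ^ (3 - q) * ε⁻¹ := fun θ hθ => by
      rw [← alpha_mul_eq hq hε (hU hθ), mul_inv_cancel_right₀ hε.ne']
    rcases hq with rfl | rfl
    · refine ((hstep.mul hstep hs0 hs0).mul (.const ε⁻¹) (B := 1) (B' := ε⁻¹) ?_ ?_).congr ?_
      · intro θ hθ
        rw [abs_mul]
        exact mul_le_one₀ (hs0 θ hθ) (abs_nonneg _) (hs0 θ hθ)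
      · exact fun θ _ => (abs_of_pos (inv_pos.2 hε)).le
      · intro θ hθ
        rw [hα θ hθ, ← sq]
    · refine (hstep.mul (.const ε⁻¹) (B' := ε⁻¹) hs0 ?_).congr ?_
      · exact fun θ _ => (abs_of_pos (inv_pos.2 hε)).le
      · intro θ hθ
        simpa using hα θ hθ
  · rcases hq with rfl | rfl
    · exact (hslope.sub (.const 1)).congr fun θ _ => by simp [slope]
    · exact hslope.neg.congr fun θ _ => by simp [slope]

/-! ### Open sets of admissible parameters and common nodes. -/

theorem exists_isOpen_subset_ranges (hη : η < 1) :
    ∃ V : Set (Param K), IsOpen V ∧ V.Nonempty ∧ V ⊆ ranges q K η := by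
  let V : Set (Param K) := {θ | ∀ k : Fin K, |θ.1 k| < (1 - η) / 4 ∧ θ.2.1 k ∈ Ioo (1 : ℝ) 2 ∧
      θ.2.2 k ∈ (if q = 1 then Ioo (0 : ℝ) (1 / 2) else Ioo (-(1 / 2) : ℝ) 0) ∧
      1 < θ.2.1 k * (1 + θ.2.2 k)}
  have e : V = ⋂ k : Fin K, {θ | |θ.1 k| < (1 - η) / 4} ∩
        ({θ | θ.2.1 k ∈ Ioo (1 : ℝ) 2} ∩
        ({θ | θ.2.2 k ∈ (if q = 1 then Ioo (0 : ℝ) (1 / 2) else Ioo (-(1 / 2) : ℝ) 0)} ∩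
        {θ | 1 < θ.2.1 k * (1 + θ.2.2 k)})) := by
    ext θ
    simp [V]
  refine ⟨V, ?_, ⟨(fun _ => 0, fun _ => 3 / 2, fun _ => if q = 1 then 1 / 4 else -(1 / 4)), ?_⟩,
    fun θ hθ k => ⟨(hθ k).1.le, Ioo_subset_Icc_self (hθ k).2.1, ?_, (hθ k).2.2.2.le⟩⟩
  · rw [e]
    refine isOpen_iInter_of_finite fun k => IsOpen.inter ?_ (IsOpen.inter ?_ (IsOpen.inter ?_ ?_))
    · exact isOpen_lt (by fun_prop) (by fun_prop)
    · exact isOpen_Ioo.preimage (by fun_prop : Continuous fun θ : Param K => θ.2.1 k)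
    · refine IsOpen.preimage (by fun_prop : Continuous fun θ : Param K => θ.2.2 k) ?_
      split_ifs <;> exact isOpen_Ioo
    · exact isOpen_lt (by fun_prop) (by fun_prop)
  · intro k
    refine ⟨by simpa using hη, by norm_num, ?_, ?_⟩ <;> split_ifs <;> norm_num
  · have := (hθ k).2.2.1
    split_ifs at this ⊢ <;> exact Ioo_subset_Icc_self this

/-- Around a reference parameter, the window from x_k + s_k/3 to x_k + s_k/2 lies strictly inside
its piece, and stays inside for nearby parameters; six nodes are picked in each window. -/
theorem exists_isOpen_nodes (hq : q = 1 ∨ q = 2) (hε : 0 < ε) (hη : η < 1) :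
    ∃ U : Set (Param K), IsOpen U ∧ U.Nonempty ∧ U ⊆ ranges q K η ∧
      ∀ k < K, ∃ s : Finset ℝ, s.card = 6 ∧
        ∀ θ ∈ U, ∀ y ∈ s, y ∈ Icc (iterate q ε θ k) (iterate q ε θ (k + 1)) := by
  obtain ⟨V, hV, ⟨θ₀, hθ₀⟩, hVr⟩ := exists_isOpen_subset_ranges (q := q) (K := K) hη
  have hpos : ∀ k < K, 0 < step q ε θ₀ k := fun k hk => step_pos hε (hVr hθ₀) hk
  let a : ℕ → ℝ := fun k => iterate q ε θ₀ k + step q ε θ₀ k / 3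
  let b : ℕ → ℝ := fun k => iterate q ε θ₀ k + step q ε θ₀ k / 2
  refine ⟨V ∩ ⋂ k : Fin K, {θ | iterate q ε θ k < a k} ∩ {θ | b k < iterate q ε θ (k + 1)},
    hV.inter (isOpen_iInter_of_finite fun k => (isOpen_lt (continuous_iterate hq _)
      continuous_const).inter (isOpen_lt continuous_const (continuous_iterate hq _))),
    ⟨θ₀, hθ₀, mem_iInter.2 fun k => ?_⟩, inter_subset_left.trans hVr, fun k hk => ?_⟩
  · have := hpos k k.2
    simp only [mem_inter_iff, mem_ofPred_eq, a, b, iterate_succ]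
    constructor <;> linarith
  · have hab : a k < b k := by
      have := hpos k hk
      simp only [a, b]
      linarith
    obtain ⟨s, hs, hcard⟩ := (Icc_infinite hab).exists_subset_card_eq 6
    refine ⟨s, hcard, fun θ hθ y hy => ?_⟩
    have h := mem_iInter.1 hθ.2 ⟨k, hk⟩
    have hy := hs hy
    exact ⟨h.1.le.trans hy.1, hy.2.trans h.2.le⟩

end Recover

/-! ### Hausdorff measure -/

/-- The control makes Ψ factor through F by a map that is Lipschitz on F '' U. Its image is a
nonempty open set, and Lipschitz maps enlarge Hausdorff measure by at most a finite factor. -/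
theorem hausdorffMeasure_image_pos {T X ι : Type*} [Fintype ι] [MetricSpace X]
    [MeasurableSpace X] [BorelSpace X] {F : T → X} {Ψ : T → ι → ℝ} {U : Set T}
    (hU : U.Nonempty) (hΨ : IsOpen (Ψ '' U))
    (h : ∀ i, ControlledOn U (fun θ θ' => dist (F θ) (F θ')) fun θ => Ψ θ i) :
    0 < Measure.hausdorffMeasure (Fintype.card ι : ℝ) (F '' U) := by
  have : Nonempty T := ⟨hU.some⟩
  choose C hC h using h
  have hdist : ∀ θ ∈ U, ∀ θ' ∈ U, dist (Ψ θ) (Ψ θ') ≤ (∑ i, C i) * dist (F θ) (F θ') := by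
    intro θ hθ θ' hθ'
    refine (dist_pi_le_iff (mul_nonneg (Finset.sum_nonneg fun i _ => hC i) dist_nonneg)).2
      fun i => (h i θ hθ θ' hθ').trans ?_
    exact mul_le_mul_of_nonneg_right
      (Finset.single_le_sum (fun i _ => hC i) (Finset.mem_univ i)) dist_nonneg
  let g : X → ι → ℝ := fun y => Ψ (Function.invFunOn F U y)
  have hg : ∀ θ ∈ U, g (F θ) = Ψ θ := by
    intro θ hθ
    have h1 := Function.invFunOn_mem (mem_image_of_mem F hθ)
    have h2 := Function.invFunOn_eq (mem_image_of_mem F hθ)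
    have h3 := hdist _ h1 θ hθ
    rw [h2, dist_self, mul_zero] at h3
    exact dist_le_zero.1 h3
  have hLip : LipschitzOnWith (∑ i, C i).toNNReal g (F '' U) := by
    refine LipschitzOnWith.of_dist_le_mul ?_
    rintro _ ⟨θ, hθ, rfl⟩ _ ⟨θ', hθ', rfl⟩
    rw [hg θ hθ, hg θ' hθ', Real.coe_toNNReal _ (Finset.sum_nonneg fun i _ => hC i)]
    exact hdist θ hθ θ' hθ'
  have himage : g '' (F '' U) = Ψ '' U := by
    rw [image_image]
    exact image_congr hg
  have hle := hLip.hausdorffMeasure_image_le (d := Fintype.card ι) (Nat.cast_nonneg _)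
  -- For the sup distance on ι → ℝ, Hausdorff measure of full dimension is Lebesgue measure.
  rw [himage, hausdorffMeasure_pi_real] at hle
  have hpos := (hΨ.measure_pos volume (hU.image Ψ)).trans_le hle
  exact pos_of_mul_pos_right hpos (by simp)

/-! ### The family of slow functions -/

theorem mem_slowFunctions {q : ℕ} {ε : ℝ} {c : Constants} (hq : q = 1 ∨ q = 2) (hε : 0 < ε)
    (hc : c.sigma0 = 2) {θ : Param (kEps q ε)} (hθ : θ ∈ ranges q (kEps q ε) c.eta1)
    {f : ℝ →ᵇ ℝ} {L : ℝ} (hf : IsSmooth L f)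
    (hd : ∀ k ≤ kEps q ε, ∀ j ≤ 2, iteratedDeriv j f (iterate q ε θ k) = data q ε θ j k) :
    f ∈ slowFunctions c q ε :=
  ⟨⟨L, hf⟩, iterate q ε θ, step q ε θ, fun _ => 2, isRun hq hε hc hθ hd, rfl,
    gradEvals_eq fun _ hk => eta1_le_rho hq hε hθ hd hk,
    hessEvals_eq fun _ hk => eta1_le_rho hq hε hθ hd hk⟩

theorem isOpenPosMeasure_volume_param (K : ℕ) :
    (volume : Measure (Param K)).IsOpenPosMeasure := by
  have h : (volume : Measure ((Fin K → ℝ) × (Fin K → ℝ))).IsOpenPosMeasure :=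
    Measure.prod.instIsOpenPosMeasure
  exact Measure.prod.instIsOpenPosMeasure

theorem hausdorffMeasure_image_ranges_pos {q K : ℕ} {ε η : ℝ} (hq : q = 1 ∨ q = 2) (hε : 0 < ε)
    (hε' : ε ≤ 1 / 4) (hη : η ∈ Ioo 0 1) (hK : K = kEps q ε) {F : Param K → (ℝ →ᵇ ℝ)}
    (hF : ∀ θ ∈ ranges q K η, (F θ : ℝ → ℝ) = spline q ε θ) :
    0 < Measure.hausdorffMeasure (3 * (K : ℝ)) (F '' ranges q K η) := by
  obtain ⟨U, hUo, hUn, hUr, hs⟩ := exists_isOpen_nodes (q := q) (K := K) hq hε hη.2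
  -- Flattens the three parameter vectors into one of 3K coordinates.
  let e : (Fin K ⊕ (Fin K ⊕ Fin K) → ℝ) ≃ₜ Param K :=
    Homeomorph.sumArrowHomeomorphProdArrow.trans
      ((Homeomorph.refl _).prodCongr Homeomorph.sumArrowHomeomorphProdArrow)
  have hcontrol := fun {k : ℕ} (hk : k < K) => controlledOn_param hq hε hε' hη hK hUr
    (D := fun θ θ' : Param K => dist (F θ) (F θ'))
    (fun θ hθ θ' hθ' t => by
      rw [← hF θ (hUr hθ), ← hF θ' (hUr hθ')]
      exact BoundedContinuousFunction.dist_coe_le_dist (f := F θ) (g := F θ') t) hs hk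
  have hpos := hausdorffMeasure_image_pos (F := F) (Ψ := fun θ => e.symm θ) hUn
    (e.symm.isOpenMap U hUo) ?_
  · have hcard : (Fintype.card (Fin K ⊕ (Fin K ⊕ Fin K)) : ℝ) = 3 * K := by
      simp only [Fintype.card_sum, Fintype.card_fin, Nat.cast_add]
      ring
    rw [hcard] at hpos
    exact hpos.trans_le (measure_mono (image_mono hUr))
  · rintro (k | k | k)
    · refine (hcontrol k.2).1.congr fun θ _ => ?_
      simp only [beta0, dif_pos k.2]
      rfl
    · refine (hcontrol k.2).2.1.congr fun θ _ => ?_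
      simp only [alpha, dif_pos k.2]
      rfl
    · refine (hcontrol k.2).2.2.congr fun θ _ => ?_
      simp only [betaQ, dif_pos k.2]
      rfl

end AR2

end

/-! ### Assembly of the theorem. -/

theorem mainTheorem2 (q : ℕ) (hq : q = 1 ∨ q = 2) :
    ∃ L M : ℝ, ∀ (ε : ℝ), 0 < ε → ε ≤ 1 / 4 →
      ∀ c : AR2.Constants, c.sigma0 = 2 →
        -- the family of functions `f_{A,B}`
        ∃ F : AR2.Param (AR2.kEps q ε) → (ℝ →ᵇ ℝ),
          (∀ θ ∈ AR2.ranges q (AR2.kEps q ε) c.eta1,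
            -- regularity, with constants depending on `q` only
            AR2.IsSmooth L (F θ) ∧
            (∀ j ≤ 2, ∀ x, |iteratedDeriv j (F θ) x| ≤ M) ∧
            AR2.IsPiecewiseQuintic (F θ) ∧
            (∀ k < AR2.kEps q ε, ∃ P : Polynomial ℝ, P.natDegree ≤ 5 ∧
              ∀ x ∈ Icc (AR2.iterate q ε θ k) (AR2.iterate q ε θ (k + 1)), F θ x = P.eval x) ∧
            -- interpolation of the perturbed data
            (∀ k ≤ AR2.kEps q ε, ∀ j ≤ 2,
              iteratedDeriv j (F θ) (AR2.iterate q ε θ k) = AR2.data q ε θ j k) ∧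
            -- slow behaviour of the algorithm, along the prescribed iterates
            AR2.IsRun c q (fun _ => ε) (F θ) 0 (AR2.kEps q ε)
              (AR2.iterate q ε θ) (AR2.step q ε θ) (fun _ => 2) ∧
            F θ ∈ AR2.slowFunctions c q ε) ∧
          -- different parameters give functions that differ near at least one iterate
          (∀ θ ∈ AR2.ranges q (AR2.kEps q ε) c.eta1,
            ∀ θ' ∈ AR2.ranges q (AR2.kEps q ε) c.eta1, θ ≠ θ' →
              ∃ k ≤ AR2.kEps q ε,
                ¬ ((F θ : ℝ → ℝ) =ᶠ[𝓝 (AR2.iterate q ε θ k)] (F θ' : ℝ → ℝ))) ∧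
          -- the parameters fill a set of nonzero Lebesgue measure, which is mapped
          -- homeomorphically onto the family, for uniform convergence on the line and for
          -- uniform convergence on compact sets
          0 < volume (AR2.ranges q (AR2.kEps q ε) c.eta1) ∧
          IsEmbedding (fun θ : AR2.ranges q (AR2.kEps q ε) c.eta1 => F θ) ∧
          IsEmbedding (fun θ : AR2.ranges q (AR2.kEps q ε) c.eta1 =>
            (F θ).toContinuousMap) ∧
          -- the family, hence the set of all slow functions, has nonzero measure
          0 < Measure.hausdorffMeasure (3 * (AR2.kEps q ε : ℝ))
            (F '' AR2.ranges q (AR2.kEps q ε) c.eta1) ∧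
          0 < Measure.hausdorffMeasure (3 * (AR2.kEps q ε : ℝ))
            (AR2.slowFunctions c q ε) := by
  refine ⟨10000, 10000, fun ε hε hε' c hc => ?_⟩
  have hη := AR2.eta1_mem c
  obtain ⟨φ, hφ, hφs⟩ :=
    AR2.exists_continuous_spline (K := AR2.kEps q ε) (η := c.eta1) hq hε hε'
  classical
  let F : AR2.Param (AR2.kEps q ε) → (ℝ →ᵇ ℝ) := fun θ =>
    if h : θ ∈ AR2.ranges q (AR2.kEps q ε) c.eta1 then φ ⟨θ, h⟩ else 0
  have hFφ : (fun θ : AR2.ranges q (AR2.kEps q ε) c.eta1 => F θ) = φ :=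
    funext fun θ => dif_pos θ.2
  have hF : ∀ θ ∈ AR2.ranges q (AR2.kEps q ε) c.eta1, (F θ : ℝ → ℝ) = AR2.spline q ε θ :=
    fun θ hθ => (congrArg _ (dif_pos hθ)).trans (hφs ⟨θ, hθ⟩)
  have hsmooth : ∀ θ ∈ AR2.ranges q (AR2.kEps q ε) c.eta1, AR2.IsSmooth 10000 (F θ) :=
    fun θ hθ => by rw [hF θ hθ]; exact AR2.isSmooth_spline hq hε hε' hη rfl hθ
  have hdata : ∀ θ ∈ AR2.ranges q (AR2.kEps q ε) c.eta1, ∀ k ≤ AR2.kEps q ε, ∀ j ≤ 2,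
      iteratedDeriv j (F θ) (AR2.iterate q ε θ k) = AR2.data q ε θ j k :=
    fun θ hθ k hk j hj => by
      rw [hF θ hθ]; exact AR2.iteratedDeriv_spline_iterate hq hε hθ hk hj
  have hslow : ∀ θ ∈ AR2.ranges q (AR2.kEps q ε) c.eta1, F θ ∈ AR2.slowFunctions c q ε :=
    fun θ hθ => AR2.mem_slowFunctions hq hε hc hθ (hsmooth θ hθ) (hdata θ hθ)
  have hcompact : CompactSpace (AR2.ranges q (AR2.kEps q ε) c.eta1) :=
    isCompact_iff_compactSpace.1 AR2.isCompact_ranges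
  have hinj : Function.Injective φ := fun θ θ' h => by
    refine Subtype.ext (AR2.eq_of_eventuallyEq_spline hq hε θ.2 θ'.2 fun k _ => ?_)
    rw [← hφs, ← hφs, h]
  have hmeas := AR2.hausdorffMeasure_image_ranges_pos hq hε hε' hη rfl hF
  refine ⟨F, fun θ hθ => ⟨hsmooth θ hθ, fun j hj x => ?_, ?_, fun k hk => ?_, hdata θ hθ,
    AR2.isRun hq hε hc hθ (hdata θ hθ), hslow θ hθ⟩, fun θ hθ θ' hθ' hne => ?_, ?_, ?_, ?_, hmeas,
    hmeas.trans_le (measure_mono (image_subset_iff.2 hslow))⟩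
  · rw [hF θ hθ, AR2.iteratedDeriv_spline hq hε hθ hj]
    exact AR2.abs_splineDeriv_le hq hε hε' hη rfl hθ hj x
  · rw [hF θ hθ]
    exact AR2.isPiecewiseQuintic_spline
  · refine ⟨AR2.piece q ε θ (k + 2), AR2.natDegree_piece_le _, fun x hx => ?_⟩
    rw [hF θ hθ]
    exact AR2.spline_eq_piece hq hε hθ hk hx
  · by_contra! h
    refine hne (AR2.eq_of_eventuallyEq_spline hq hε hθ hθ' fun k hk => ?_)
    rw [← hF θ hθ, ← hF θ' hθ']
    exact h k hk
  · obtain ⟨V, hV, hVn, hVr⟩ := AR2.exists_isOpen_subset_ranges (q := q) (K := AR2.kEps q ε) hη.2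
    have := AR2.isOpenPosMeasure_volume_param (AR2.kEps q ε)
    exact (hV.measure_pos volume hVn).trans_le (measure_mono hVr)
  · rw [hFφ]
    -- A continuous injection of a compact space into a Hausdorff space is a closed embedding; the
    -- same argument serves for the compact-open topology.
    exact (hφ.isClosedEmbedding hinj).isEmbedding
  · have hcont : Continuous fun θ => (φ θ).toContinuousMap :=
      ContinuousMap.continuous_of_continuous_uncurry _
        ((hφ.comp continuous_fst).eval continuous_snd)
    have hcomp : (fun θ : AR2.ranges q (AR2.kEps q ε) c.eta1 => (F θ).toContinuousMap)
        = fun θ => (φ θ).toContinuousMap :=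
      funext fun θ => congrArg BoundedContinuousFunction.toContinuousMap (congrFun hFφ θ)
    rw [hcomp]
    refine (hcont.isClosedEmbedding fun θ θ' h => hinj ?_).isEmbedding
    exact BoundedContinuousFunction.ext fun t => DFunLike.congr_fun h t
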